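/- Fix a finite alphabet $\mathcal A$ with at least two letters and an acceptable enumeration $(\varphi_n)_{n\in\mathbb N}$ of the one-input partial recursive functions on $\mathbb N$; write $W_n=\operatorname{dom}\varphi_n$. A context-free grammar (CFG) over the terminal alphabet $\mathcal A$, with start symbol $S$, is \emph{productive} if the right-hand side of every production contains at least one terminal symbol. A productive CFG is \emph{total} if $S$ generates every nonempty word over $\mathcal A$. It is \emph{regularly total} if it has two nonterminals $Y$ and $T$ ($S,Y,T$ pairwise distinct) such that - for every $a\in\mathcal A$ it contains the productions $S\Rightarrow aYT$, $T\Rightarrow a$ and $T\Rightarrow aT$; and - there is some $n>0$ such that $S$ generates all nonempty words of length at most $n+1$ and $Y$ generates all words of length $n$. Identify CFGs with their Gödel numbers under a standard computable encoding. Let $\mathbf R\subseteq\mathbb N$ be the set of (Gödel numbers of) productive CFGs over $\mathcal A$ that are regularly total, and let $\overline{\mathrm{Tot}}\subseteq\mathbb N$ be the set of (Gödel numbers of) productive CFGs over $\mathcal A$ that are not total. Theorem. The sets $\mathbf R$ and $\overline{\mathrm{Tot}}$ are effectively inseparable; that is, $\mathbf R\cap\overline{\mathrm{Tot}}=\emptyset$,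 and there is a partial recursive function $h(x,y)$ such that, whenever $W_u\supseteq\mathbf R$, $W_v\supseteq\overline{\mathrm{Tot}}$ and $W_u\cap W_v=\emptyset$, the value $h(u,v)$ is defined and $h(u,v)\notin W_u\cup W_v$. -/

import Mathlib

/-! ### Productive, total and regularly total context-free grammars -/

namespace ContextFreeGrammar

variable {A : Type*}

/-- The nonterminal `X` of the grammar `g` generates the terminal word `w`. -/
def GeneratesFrom (g : ContextFreeGrammar A) (X : g.NT) (w : List A) : Prop :=
  g.Derives [Symbol.nonterminal X] (w.map Symbol.terminal)

/-- Every production has a terminal symbol on its right-hand side. -/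
def IsProductive (g : ContextFreeGrammar A) : Prop :=
  ∀ r ∈ g.rules, ∃ a : A, Symbol.terminal a ∈ r.output

/-- The start symbol generates all nonempty words over the terminal alphabet. -/
def IsTotal (g : ContextFreeGrammar A) : Prop :=
  ∀ w : List A, w ≠ [] → g.GeneratesFrom g.initial w

/-- With `S` the start symbol, there are nonterminals `Y` and `T` (the three letters `S`, `Y`, `T`
standing for three different nonterminals) such that all the productions
`S ⇒ a Y T`, `T ⇒ a` and `T ⇒ a T` are present, and for some `n > 0`, `S` generates all
nonempty words of length at most `n + 1` and `Y` generates all words of length `n`. -/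
def IsRegularlyTotal (g : ContextFreeGrammar A) : Prop :=
  ∃ Y T : g.NT, Y ≠ T ∧ Y ≠ g.initial ∧ T ≠ g.initial ∧
    (∀ a : A,
      ⟨g.initial, [Symbol.terminal a, Symbol.nonterminal Y, Symbol.nonterminal T]⟩ ∈ g.rules ∧
      ⟨T, [Symbol.terminal a]⟩ ∈ g.rules ∧
      ⟨T, [Symbol.terminal a, Symbol.nonterminal T]⟩ ∈ g.rules) ∧
    ∃ n : ℕ, 0 < n ∧
      (∀ w : List A, w ≠ [] → w.length ≤ n + 1 → g.GeneratesFrom g.initial w) ∧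
      (∀ w : List A, w.length = n → g.GeneratesFrom Y w)

end ContextFreeGrammar

/-! ### Gödel numbers of grammars over the alphabet `Fin k` -/

/-- A concrete grammar over the terminal alphabet `Fin k`, with nonterminals taken from the
countably infinite set `ℕ`: its start symbol and the finite list of its productions, a production
being a pair of its left-hand side and its right-hand side (`Sum.inl` marks terminals and
`Sum.inr` marks nonterminals). The Gödel number of such an object is its `Encodable.encode`. -/
abbrev GrammarCode (k : ℕ) : Type := ℕ × List (ℕ × List (Fin k ⊕ ℕ))

namespace GrammarCode

/-- The production that a pair stands for. -/
def toRule {k : ℕ} (p : ℕ × List (Fin k ⊕ ℕ)) : ContextFreeRule (Fin k) ℕ :=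
  ⟨p.1, p.2.map (Sum.elim Symbol.terminal Symbol.nonterminal)⟩

/-- The context-free grammar that a concrete grammar stands for. -/
abbrev toGrammar {k : ℕ} (G : GrammarCode k) : ContextFreeGrammar (Fin k) where
  NT := ℕ
  initial := G.1
  rules := (G.2.map toRule).toFinset

/-- Gödel numbers of the productive grammars over `Fin k` that are regularly total. -/
def regularlyTotal (k : ℕ) : Set ℕ :=
  {m | ∃ G : GrammarCode k, Encodable.encode G = m ∧
    (toGrammar G).IsProductive ∧ (toGrammar G).IsRegularlyTotal}

/-- Gödel numbers of the productive grammars over `Fin k` that are not total. -/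
def nonTotal (k : ℕ) : Set ℕ :=
  {m | ∃ G : GrammarCode k, Encodable.encode G = m ∧
    (toGrammar G).IsProductive ∧ ¬ (toGrammar G).IsTotal}

end GrammarCode

/-! ### Acceptable enumerations and effective inseparability -/

/-- `φ` is an acceptable enumeration of the one-input partial recursive functions on `ℕ`: it is
uniformly partial recursive, and from an index in any other uniformly partial recursive family
one can compute an index in `φ` of the same function. -/
structure IsAcceptableEnumeration (φ : ℕ → ℕ →. ℕ) : Prop where
  partrec : Partrec₂ φ
  translate : ∀ ψ : ℕ → ℕ →. ℕ, Partrec₂ ψ →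
    ∃ f : ℕ → ℕ, Computable f ∧ ∀ e, φ (f e) = ψ e

/-- The `n`-th recursively enumerable set: the domain of the `n`-th function. -/
def reSet (φ : ℕ → ℕ →. ℕ) (n : ℕ) : Set ℕ := {x | (φ n x).Dom}

/-- Effective inseparability of `A` and `B`, relative to the enumeration `φ`. -/
def EffectivelyInseparable (φ : ℕ → ℕ →. ℕ) (A B : Set ℕ) : Prop :=
  A ∩ B = ∅ ∧
  ∃ h : ℕ → ℕ →. ℕ, Partrec₂ h ∧
    ∀ u v : ℕ, A ⊆ reSet φ u → B ⊆ reSet φ v → reSet φ u ∩ reSet φ v = ∅ →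
      ∃ y ∈ h u v, y ∉ reSet φ u ∪ reSet φ v

/-! ### Register programs -/

/-! Regular totality implies totality, whence disjointness: a word longer than n + 1 splits into one
letter, n letters and a nonempty rest, and S ⇒ aYT generates it (`IsRegularlyTotal.isTotal`).

For inseparability it suffices, given a partial recursive f, to compute from z a grammar that is
regularly total if f z = 0 and not total if f z has a nonzero value (`exists_reduction`); nothing is
asked if f z diverges. Applied to a universal function, this yields h by diagonalisation, without
the recursion theorem (`effectivelyInseparable_of_reduction`).

The computation of f z is turned into the iteration of a piecewise affine map, as in generalised
Collatz problems: a register program becomes a flat machine, register contents become exponents of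
primes, and every instruction acts affinely on each residue class modulo a fixed N
(`exists_simulation`). Only the initial value depends on z. The value 0 of f leads to a number
without admissible successor (acceptance), any other value to a number followed by 0, which is
followed by itself (rejection).

A sequence of numbers is written as a word of unary blocks, each preceded by a separator, with one
arbitrary letter in front. A wrong initial block, or a pair of neighbouring blocks against the
table, is recognised by a context-free grammar, since the table consists of affine inequalities. Y
generates words with such a violation; S adds words of length at most three and words whose second
or third letter from the end is a tick. If the iteration rejects, the history can be prolonged by
zeros so as to end in three separators, and it escapes S (`exists_sound`). If it accepts, every word
that is not a prefix of one fixed word without adjacent separators shows a violation once a letter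
is appended. Hence S is total, and Y generates all words of some fixed length (`exists_complete`).
-/

/-- Programs for machines with registers indexed by `ℕ`. The program `loop r c` decrements the
register `r` and runs `c`, as long as `r` is nonzero. -/
inductive RegProg : Type
  | skip : RegProg
  | inc (r : ℕ) : RegProg
  | seq (c d : RegProg) : RegProg
  | loop (r : ℕ) (c : RegProg) : RegProg

namespace RegProg

open Function

/-- `Exec c σ σ'`: the program `c`, started with register contents `σ`, halts with `σ'`. -/
inductive Exec : RegProg → (ℕ → ℕ) → (ℕ → ℕ) → Prop
  | skip (σ : ℕ → ℕ) : Exec skip σ σ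
  | inc (r : ℕ) (σ : ℕ → ℕ) : Exec (inc r) σ (update σ r (σ r + 1))
  | seq {c d : RegProg} {σ σ' σ'' : ℕ → ℕ} :
      Exec c σ σ' → Exec d σ' σ'' → Exec (seq c d) σ σ''
  | loop_zero {r : ℕ} (c : RegProg) {σ : ℕ → ℕ} : σ r = 0 → Exec (loop r c) σ σ
  | loop_succ {r : ℕ} {c : RegProg} {σ σ' σ'' : ℕ → ℕ} : σ r ≠ 0 →
      Exec c (update σ r (σ r - 1)) σ' → Exec (loop r c) σ' σ'' → Exec (loop r c) σ σ''

theorem Exec.of_eq {c : RegProg} {σ σ' σ'' : ℕ → ℕ} (h : Exec c σ σ') (e : σ' = σ'') :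
    Exec c σ σ'' := e ▸ h

theorem Exec.of_eq_left {c : RegProg} {σ σ' σ'' : ℕ → ℕ} (h : Exec c σ σ') (e : σ = σ'') :
    Exec c σ'' σ' := e ▸ h

/-- A loop invariant: `s i` is the state at the test before pass `i`, so that exhibiting `s`
replaces an induction for each loop. -/
theorem Exec.loop_of_family {r : ℕ} {c : RegProg} (n : ℕ) (s : ℕ → ℕ → ℕ)
    (hpos : ∀ i < n, s i r ≠ 0)
    (hstep : ∀ i < n, Exec c (update (s i) r (s i r - 1)) (s (i + 1)))
    (hzero : s n r = 0) : Exec (loop r c) (s 0) (s n) := by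
  induction n generalizing s with
  | zero => exact .loop_zero c hzero
  | succ n ih =>
    exact .loop_succ (hpos 0 (by omega)) (hstep 0 (by omega))
      (ih (fun i => s (i + 1)) (fun i hi => hpos _ (by omega))
        (fun i hi => hstep _ (by omega)) hzero)

/-- Set the register `r` to zero. -/
def clear (r : ℕ) : RegProg := loop r skip

theorem exec_clear (r : ℕ) (σ : ℕ → ℕ) : Exec (clear r) σ (update σ r 0) := by
  have h := Exec.loop_of_family (r := r) (c := skip) (σ r) (fun i => update σ r (σ r - i))
    (by intro i hi; simp; omega)
    (by
      intro i hi
      refine (Exec.skip _).of_eq ?_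
      funext x
      simp only [update_apply]
      split_ifs <;> omega)
    (by simp)
  simpa [clear] using h

/-- Add the contents of the register `r` to the register `t` and set `r` to zero. -/
def move (r t : ℕ) : RegProg := loop r (inc t)

theorem exec_move {r t : ℕ} (hrt : r ≠ t) (σ : ℕ → ℕ) :
    Exec (move r t) σ (update (update σ t (σ t + σ r)) r 0) := by
  have h := Exec.loop_of_family (r := r) (c := inc t) (σ r)
    (fun i => update (update σ t (σ t + i)) r (σ r - i))
    (by intro i hi; simp; omega)
    (by
      intro i hi
      refine (Exec.inc _ _).of_eq ?_
      funext x
      simp only [update_apply]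
      split_ifs <;> omega)
    (by simp)
  simpa [move] using h

/-- Add the contents of the register `r` to the register `t`, using the scratch register `u`. -/
def copy (r t u : ℕ) : RegProg := seq (loop r (seq (inc t) (inc u))) (move u r)

theorem exec_copy {r t u : ℕ} (hrt : r ≠ t) (hru : r ≠ u) (htu : t ≠ u) {σ : ℕ → ℕ}
    (hu : σ u = 0) : Exec (copy r t u) σ (update σ t (σ t + σ r)) := by
  have h := Exec.loop_of_family (r := r) (c := seq (inc t) (inc u)) (σ r)
    (fun i => update (update (update σ t (σ t + i)) u i) r (σ r - i))
    (by intro i hi; simp; omega)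
    (by
      intro i hi
      refine ((Exec.inc _ _).seq (Exec.inc _ _)).of_eq ?_
      funext x
      simp only [update_apply]
      split_ifs <;> omega)
    (by simp)
  refine Exec.seq (h.of_eq_left ?_) ((exec_move hru.symm _).of_eq ?_)
  · funext x
    simp only [update_apply]
    split_ifs <;> simp_all
  · funext x
    simp only [update_apply]
    split_ifs <;> simp_all

/-- Any finite sequence of consecutive registers can be set to zero. -/
theorem exists_exec_clear_range (b n : ℕ) :
    ∃ c, ∀ σ, Exec c σ fun x => if b ≤ x ∧ x < b + n then 0 else σ x := by
  induction n with
  | zero =>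
    refine ⟨skip, fun σ => (Exec.skip σ).of_eq ?_⟩
    funext x
    rw [if_neg (by omega)]
  | succ n ih =>
    obtain ⟨c, hc⟩ := ih
    refine ⟨seq c (clear (b + n)), fun σ => ((hc σ).seq (exec_clear _ _)).of_eq ?_⟩
    funext x
    simp only [update_apply]
    split_ifs <;> first | rfl | omega

/-- The program `c` writes into the empty register `out` the value of `f` at the contents of the
registers `ins`, provided that all the registers from `b` on are empty. -/
def Computes {n : ℕ} (c : RegProg) (f : List.Vector ℕ n → ℕ) (ins : Fin n → ℕ) (out b : ℕ) :
    Prop :=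
  ∀ σ : ℕ → ℕ, (∀ x, b ≤ x → σ x = 0) → σ out = 0 →
    Exec c σ (update σ out (f (List.Vector.ofFn fun i => σ (ins i))))

/-- For composition: the value of `g i` goes to register `b + i`, and scratch space starts at `b +
ι`, above all these outputs. As `Computes` leaves every other register as it was, the inputs survive
for the next function. -/
theorem exists_computes_family {m : ℕ} {ι : ℕ} (g : Fin ι → List.Vector ℕ m → ℕ)
    (hg : ∀ i, ∀ (ins : Fin m → ℕ) (out b : ℕ), (∀ i, ins i < b) → out < b →
      (∀ i, ins i ≠ out) → ∃ c, Computes c (g i) ins out b)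
    (ins : Fin m → ℕ) (b : ℕ) (hins : ∀ i, ins i < b) (j : ℕ) (hj : j ≤ ι) :
    ∃ c, ∀ σ : ℕ → ℕ, (∀ x, b ≤ x → σ x = 0) →
      Exec c σ fun x => if h : b ≤ x ∧ x < b + j then
        g ⟨x - b, by omega⟩ (List.Vector.ofFn fun i => σ (ins i)) else σ x := by
  induction j with
  | zero =>
    refine ⟨skip, fun σ _ => (Exec.skip σ).of_eq ?_⟩
    funext x
    rw [dif_neg (by omega)]
  | succ j ih =>
    obtain ⟨c, hc⟩ := ih (by omega)
    obtain ⟨d, hd⟩ := hg ⟨j, by omega⟩ ins (b + j) (b + ι) (fun i => by have := hins i; omega)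
      (by omega) (fun i => by have := hins i; omega)
    refine ⟨seq c d, fun σ hσ => ((hc σ hσ).seq (hd _ ?_ ?_)).of_eq ?_⟩
    · intro x hx
      rw [dif_neg (by omega)]
      exact hσ x (by omega)
    · rw [dif_neg (by omega)]
      exact hσ _ (by omega)
    · have e : (List.Vector.ofFn fun i => if h : b ≤ ins i ∧ ins i < b + j then
          g ⟨ins i - b, by omega⟩ (List.Vector.ofFn fun i => σ (ins i)) else σ (ins i))
          = List.Vector.ofFn fun i => σ (ins i) := by
        congr 1
        funext i
        have := hins i
        rw [dif_neg (by omega)]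
      rw [e]
      funext x
      by_cases hx : x = b + j
      · subst hx
        rw [update_self, dif_pos (by omega)]
        congr 2
        simp
      · rw [update_of_ne hx]
        by_cases h : b ≤ x ∧ x < b + j
        · rw [dif_pos h, dif_pos (by omega)]
        · rw [dif_neg h, dif_neg (by omega)]

/-- Primitive recursive functions are computed by register programs. -/
theorem exists_computes {n : ℕ} {f : List.Vector ℕ n → ℕ} (hf : Nat.Primrec' f)
    (ins : Fin n → ℕ) (out b : ℕ) (hins : ∀ i, ins i < b) (hout : out < b)
    (hne : ∀ i, ins i ≠ out) : ∃ c, Computes c f ins out b := by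
  induction hf generalizing out b with
  | zero =>
    refine ⟨skip, fun σ _ h0 => (Exec.skip σ).of_eq ?_⟩
    funext x
    simp only [update_apply]
    split_ifs <;> simp_all
  | succ =>
    refine ⟨seq (copy (ins 0) out b) (inc out), fun σ hσ h0 =>
      ((exec_copy (hne 0) (by have := hins 0; omega) (by omega) (hσ b le_rfl)).seq
        (Exec.inc _ _)).of_eq ?_⟩
    simp [h0]
  | get i =>
    refine ⟨copy (ins i) out b, fun σ hσ h0 =>
      (exec_copy (hne i) (by have := hins i; omega) (by omega) (hσ b le_rfl)).of_eq ?_⟩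
    simp [h0]
  | @comp m k f g hf hg ihf ihg =>
    obtain ⟨c, hc⟩ := exists_computes_family g (fun i ins out b h1 h2 h3 => ihg i ins out b h1 h2 h3)
      ins b hins k le_rfl
    obtain ⟨d, hd⟩ := ihf (fun i => b + i) out (b + k) (fun i => by omega) (by omega)
      (fun i => by omega)
    obtain ⟨e, he⟩ := exists_exec_clear_range b k
    refine ⟨seq c (seq d e), fun σ hσ h0 => ((hc σ hσ).seq ((hd _ ?_ ?_).seq (he _))).of_eq ?_⟩
    · intro x hx
      rw [dif_neg (by omega)]
      exact hσ x (by omega)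
    · rw [dif_neg (by omega)]
      exact h0
    · have e1 : (List.Vector.ofFn fun i : Fin k => if h : b ≤ b + (i : ℕ) ∧ b + (i : ℕ) < b + k then
          g ⟨b + i - b, by omega⟩ (List.Vector.ofFn fun i => σ (ins i)) else σ (b + i))
          = List.Vector.ofFn fun i => g i (List.Vector.ofFn fun i => σ (ins i)) := by
        congr 1
        funext i
        rw [dif_pos (by omega)]
        congr 2
        simp
      rw [e1]
      funext x
      by_cases hx : b ≤ x ∧ x < b + k
      · rw [if_pos hx, update_of_ne (by omega), hσ x hx.1]
      · rw [if_neg hx]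
        simp only [update_apply]
        rw [dif_neg hx]
  | @prec k f g hf hg ihf ihg =>
    obtain ⟨c, hc⟩ := ihf (fun i => ins i.succ) out (b + 3)
      (fun i => by have := hins i.succ; omega) (by omega) (fun i => hne _)
    obtain ⟨d, hd⟩ := ihg (Fin.cons (b + 1) (Fin.cons out fun i => ins i.succ)) (b + 2) (b + 3)
      (fun i => by
        refine Fin.cases ?_ (fun i => Fin.cases ?_ (fun i => ?_) i) i
        · simp
        · simp; omega
        · have := hins i.succ; simp; omega) (by omega)
      (fun i => by
        refine Fin.cases ?_ (fun i => Fin.cases ?_ (fun i => ?_) i) i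
        · simp
        · simp; omega
        · have := hins i.succ; simp; omega)
    -- Register `b` counts the remaining passes, `b + 1` holds the recursion index, `out` the
    -- current value, and `b + 2` receives the new value before `out` is overwritten.
    refine ⟨seq (copy (ins 0) b (b + 2)) (seq c (seq (loop b (seq d (seq (clear out)
      (seq (move (b + 2) out) (inc (b + 1)))))) (clear (b + 1)))), fun σ hσ h0 => ?_⟩
    set v : List.Vector ℕ k := List.Vector.ofFn fun i => σ (ins i.succ) with hv
    have hin0 := hins 0
    set R : ℕ → ℕ := fun i => i.rec (f v) fun y IH => g (y ::ᵥ IH ::ᵥ v) with hR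
    have hloop := Exec.loop_of_family (r := b) (c := seq d (seq (clear out)
      (seq (move (b + 2) out) (inc (b + 1))))) (σ (ins 0))
      (fun i => update (update (update σ b (σ (ins 0) - i)) (b + 1) i) out (R i))
      (by
        intro i hi
        simp only [update_apply]
        split_ifs <;> omega)
      (by
        intro i hi
        refine ((hd _ ?_ ?_).seq ((exec_clear _ _).seq
          ((exec_move (by omega) _).seq (Exec.inc _ _)))).of_eq ?_
        · intro x hx
          have := hσ x (by omega)
          simp only [update_apply]
          split_ifs <;> omega
        · have := hσ (b + 2) (by omega)
          simp only [update_apply]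
          split_ifs <;> omega
        · have e : ∀ τ : ℕ → ℕ, τ (b + 1) = i → τ out = R i → (∀ i : Fin k, τ (ins i.succ)
              = σ (ins i.succ)) → g (List.Vector.ofFn fun j =>
              τ ((Fin.cons (b + 1) (Fin.cons out fun i => ins i.succ) : Fin (k + 2) → ℕ) j))
              = R (i + 1) := by
            intro τ h1 h2 h3
            change _ = g (i ::ᵥ R i ::ᵥ v)
            congr 1
            rw [List.Vector.ofFn, List.Vector.ofFn]
            simp [h1, h2, h3, hv]
          rw [e]
          · funext x
            simp only [update_apply]
            have := hσ (b + 2) (by omega)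
            split_ifs <;> first | rfl | omega | (subst_vars; omega)
          · simp only [update_apply]
            split_ifs <;> omega
          · simp only [update_apply]
            split_ifs <;> first | rfl | omega
          · intro j
            have := hins j.succ
            have := hne j.succ
            simp only [update_apply]
            split_ifs <;> first | rfl | omega)
      (by
        simp only [update_apply]
        split_ifs <;> omega)
    refine ((exec_copy (by omega) (by omega) (by omega) (hσ _ (by omega))).seq
      ((hc _ ?_ ?_).seq (Exec.seq (hloop.of_eq_left ?_) (exec_clear _ _)))).of_eq ?_
    · intro x hx
      have := hσ x (by omega)
      rw [update_of_ne (by omega), this]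
    · rw [update_of_ne (by omega), h0]
    · have e : (List.Vector.ofFn fun i : Fin k =>
          update σ b (σ b + σ (ins 0)) (ins i.succ)) = v := by
        rw [hv]
        congr 1
        funext i
        have := hins i.succ
        rw [update_of_ne (by omega)]
      rw [e]
      have h1 := hσ b (by omega)
      have h2 := hσ (b + 1) (by omega)
      funext x
      simp only [update_apply]
      split_ifs <;> first | rfl | omega | (subst_vars; omega)
    · have h1 := hσ b (by omega)
      have h2 := hσ (b + 1) (by omega)
      have e : (List.Vector.ofFn fun i => σ (ins i)) = σ (ins 0) ::ᵥ v := by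
        rw [hv, List.Vector.ofFn]
      rw [e]
      change _ = update σ out (R (σ (ins 0)))
      funext x
      simp only [update_apply]
      split_ifs <;> first | rfl | omega | (subst_vars; omega)

/-- A program that searches for the least zero of a primitive recursive function `s`, and then
evaluates `d` there. -/
theorem exists_exec_search {s d : List.Vector ℕ 2 → ℕ} (hs : Nat.Primrec' s)
    (hd : Nat.Primrec' d) : ∃ c, ∀ z k : ℕ, s (k ::ᵥ z ::ᵥ .nil) = 0 →
      (∀ i < k, s (i ::ᵥ z ::ᵥ .nil) ≠ 0) →
      ∃ σ', Exec c (update (fun _ => 0) 0 z) σ' ∧ σ' 2 = d (k ::ᵥ z ::ᵥ .nil) := by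
  have hi : ∀ {b : ℕ}, 1 < b → ∀ i, (Fin.cons 1 (Fin.cons 0 Fin.elim0) : Fin 2 → ℕ) i < b := by
    intro b hb i
    fin_cases i
    · exact hb
    · exact Nat.lt_trans Nat.zero_lt_one hb
  have hn : ∀ {b : ℕ}, 1 < b → ∀ i, (Fin.cons 1 (Fin.cons 0 Fin.elim0) : Fin 2 → ℕ) i ≠ b :=
    fun hb i => (hi hb i).ne
  obtain ⟨c, hc⟩ := exists_computes hs (Fin.cons 1 (Fin.cons 0 Fin.elim0)) 3 4
    (hi (by omega)) (by omega) (hn (by omega))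
  obtain ⟨e, he⟩ := exists_computes hd (Fin.cons 1 (Fin.cons 0 Fin.elim0)) 2 4
    (hi (by omega)) (by omega) (hn (by omega))
  -- Register 0 holds the input, 1 the candidate, 3 the value of `s` there, and 2 the output. As
  -- `loop` takes away only one unit, the body first clears the rest of register 3.
  refine ⟨seq c (seq (loop 3 (seq (clear 3) (seq (inc 1) c))) e), fun z k h0 hpos => ?_⟩
  set st : ℕ → ℕ → ℕ := fun i => update (update (update (fun _ => 0) 0 z) 1 i) 3
    (s (i ::ᵥ z ::ᵥ .nil)) with hst
  have hcs : ∀ i, Exec c (update (update (fun _ => 0) 0 z) 1 i) (st i) := by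
    intro i
    refine (hc _ ?_ (by simp)).of_eq ?_
    · intro x hx
      simp only [update_apply]
      split_ifs <;> omega
    · simp [hst, List.Vector.ofFn]
  have hloop := Exec.loop_of_family (r := 3) (c := seq (clear 3) (seq (inc 1) c)) k st
    (fun i hi => by simpa [hst] using hpos i hi)
    (fun i hi => by
      refine (exec_clear _ _).seq ((Exec.inc _ _).seq ((hcs (i + 1)).of_eq_left ?_))
      funext x
      simp only [hst, update_apply]
      split_ifs <;> simp_all)
    (by simpa [hst] using h0)
  have h1 : Exec c (update (fun _ => 0) 0 z) (st 0) := by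
    refine (hcs 0).of_eq_left ?_
    funext x
    simp only [update_apply]
    split_ifs <;> simp_all
  refine ⟨_, h1.seq (hloop.seq (he _ ?_ ?_)), ?_⟩
  · intro x hx
    simp only [hst, update_apply]
    split_ifs <;> omega
  · simp [hst]
  · simp [hst, List.Vector.ofFn]

end RegProg

/-! ### Iteration of piecewise affine functions -/

/-- Instructions of a flat register machine; `t` and `t'` are jump targets. -/
inductive RegInstr : Type
  | inc (r t : ℕ) : RegInstr
  | dec (r t t' : ℕ) : RegInstr
  | jump (t : ℕ) : RegInstr
  | halt (accept : Bool) : RegInstr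

/-- A table assigns to a residue a triple `(a, l, o)`. In the residue class `x` modulo `N`, the
number `N * t + x` may be followed by the numbers `j` with `a * t + l ≤ j < a * t + o`. -/
abbrev AffineTable : Type := ℕ → ℕ × ℕ × ℕ

/-- By the table `τ`, the number `n` has exactly one successor, it is `n'`, and the constant term
of its affine expression is positive. -/
def AffineTable.Step (τ : AffineTable) (N n n' : ℕ) : Prop :=
  n' = (τ (n % N)).1 * (n / N) + (τ (n % N)).2.1 ∧
    (τ (n % N)).2.2 = (τ (n % N)).2.1 + 1 ∧ 1 ≤ (τ (n % N)).2.1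

namespace RegProg

open Function

/-- The number of instructions of the flat form of a program. -/
def size : RegProg → ℕ
  | skip => 1
  | inc _ => 1
  | seq c d => c.size + d.size
  | loop _ c => c.size + 1

/-- A strict upper bound of the registers in a program. -/
def bound : RegProg → ℕ
  | skip => 0
  | inc r => r + 1
  | seq c d => max c.bound d.bound
  | loop r c => max (r + 1) c.bound

/-- `c.code s e` is the flat form of `c` at the addresses from `s` on, with exit to `e`. -/
def code : RegProg → ℕ → ℕ → ℕ → RegInstr
  | skip, _, e, _ => .jump e
  | inc r, _, e, _ => .inc r e
  | seq c d, s, e, q => if q < s + c.size then c.code s (s + c.size) q else d.code (s + c.size) e q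
  | loop r c, s, e, q => if q = s then .dec r (s + 1) e else c.code (s + 1) s q

theorem size_pos (c : RegProg) : 0 < c.size := by
  induction c <;> simp only [size] <;> omega

/-- Register contents as the exponents of the primes. -/
noncomputable def primeCode (K : ℕ) (σ : ℕ → ℕ) : ℕ := ∏ i ∈ Finset.range K, Nat.nth Nat.Prime i ^ σ i

theorem primeCode_update_succ {K r : ℕ} (hr : r < K) (σ : ℕ → ℕ) :
    primeCode K (update σ r (σ r + 1)) = Nat.nth Nat.Prime r * primeCode K σ := by
  have hm : r ∈ Finset.range K := Finset.mem_range.2 hr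
  rw [primeCode, primeCode, ← Finset.mul_prod_erase _ _ hm, ← Finset.mul_prod_erase _ _ hm,
    update_self, pow_succ']
  rw [mul_assoc]
  congr 2
  refine Finset.prod_congr rfl fun i hi => ?_
  rw [update_of_ne (Finset.ne_of_mem_erase hi)]

theorem primeCode_update_pred {K r : ℕ} (hr : r < K) {σ : ℕ → ℕ} (h : σ r ≠ 0) :
    Nat.nth Nat.Prime r * primeCode K (update σ r (σ r - 1)) = primeCode K σ := by
  rw [← primeCode_update_succ hr, update_self, update_idem, Nat.sub_add_cancel (by omega),
    update_eq_self]

theorem not_dvd_primeCode {K r : ℕ} {σ : ℕ → ℕ} (h : σ r = 0) :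
    ¬ Nat.nth Nat.Prime r ∣ primeCode K σ := by
  intro hd
  have hp := Nat.prime_nth_prime r
  obtain ⟨i, -, hi⟩ := (hp.prime.dvd_finsetProd_iff _).1 hd
  have h1 := (Nat.prime_dvd_prime_iff_eq hp (Nat.prime_nth_prime i)).1 (hp.dvd_of_dvd_pow hi)
  have h2 : r = i := Nat.nth_injective Nat.infinite_setOfPred_prime h1
  subst h2
  rw [h, pow_zero, Nat.dvd_one] at hi
  exact hp.ne_one hi

/-- The product of the first `K` primes. -/
noncomputable def primeProd (K : ℕ) : ℕ := primeCode K fun _ => 1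

theorem primeProd_pos (K : ℕ) : 0 < primeProd K := by
  unfold primeProd primeCode
  exact Finset.prod_pos fun i _ => pow_pos (Nat.prime_nth_prime i).pos _

theorem dvd_primeProd {K r : ℕ} (hr : r < K) : Nat.nth Nat.Prime r ∣ primeProd K :=
  ⟨_, (primeCode_update_pred (σ := fun _ => 1) hr one_ne_zero).symm⟩

/-- The table that simulates the machine with the instructions `I` at the addresses below `Q` and
with the registers below `K`, in the address `q` and with register contents of prime code `m`
represented by `Q * m + q`. -/
noncomputable def table (Q K : ℕ) (I : ℕ → RegInstr) : AffineTable := fun x =>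
  match I (x % Q) with
  | .inc r t =>
    (Q * (Nat.nth Nat.Prime r * primeProd K), Q * (Nat.nth Nat.Prime r * (x / Q)) + t,
      Q * (Nat.nth Nat.Prime r * (x / Q)) + t + 1)
  | .dec r t t' =>
    if Nat.nth Nat.Prime r ∣ x / Q then
      (Q * (primeProd K / Nat.nth Nat.Prime r), Q * (x / Q / Nat.nth Nat.Prime r) + t,
        Q * (x / Q / Nat.nth Nat.Prime r) + t + 1)
    else (Q * primeProd K, Q * (x / Q) + t', Q * (x / Q) + t' + 1)
  | .jump t => (Q * primeProd K, Q * (x / Q) + t, Q * (x / Q) + t + 1)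
  | .halt true => (0, 1, 1)
  | .halt false => (0, 0, 1)

/-! ### One step of the table for each kind of instruction -/

section Table

variable {Q K q : ℕ} (I : ℕ → RegInstr) (m : ℕ)

theorem residue_mod (hq : q < Q) : (Q * m + q) % (Q * primeProd K) % Q = q := by
  rw [Nat.mod_mul_right_mod, Nat.mul_add_mod, Nat.mod_eq_of_lt hq]

theorem residue_div (hq : q < Q) :
    (Q * m + q) % (Q * primeProd K) / Q = m % primeProd K := by
  rw [Nat.mod_mul_right_div_self, Nat.mul_add_div (by omega), Nat.div_eq_of_lt hq, add_zero]

theorem quotient_eq (hq : q < Q) : (Q * m + q) / (Q * primeProd K) = m / primeProd K := by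
  rw [← Nat.div_div_eq_div_mul, Nat.mul_add_div (by omega), Nat.div_eq_of_lt hq, add_zero]

/-- Writing `m = P * (m / P) + m % P`, with `P` the product of the primes, makes the new number
affine in `m / P`. The target address is positive because `AffineTable.Step` wants a positive
constant term, on which `generates_under` and the nonemptiness of blocks rely. -/
theorem table_step_inc {r t : ℕ} (hq : q < Q) (hI : I q = .inc r t) (ht : 1 ≤ t) :
    (table Q K I).Step (Q * primeProd K) (Q * m + q) (Q * (Nat.nth Nat.Prime r * m) + t) := by
  unfold AffineTable.Step table
  rw [residue_mod m hq, residue_div m hq, quotient_eq m hq, hI]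
  refine ⟨?_, rfl, by simp only; omega⟩
  conv_lhs => rw [← Nat.div_add_mod m (primeProd K)]
  ring

theorem table_step_jump {t : ℕ} (hq : q < Q) (hI : I q = .jump t) (ht : 1 ≤ t) :
    (table Q K I).Step (Q * primeProd K) (Q * m + q) (Q * m + t) := by
  unfold AffineTable.Step table
  rw [residue_mod m hq, residue_div m hq, quotient_eq m hq, hI]
  refine ⟨?_, rfl, by simp only; omega⟩
  conv_lhs => rw [← Nat.div_add_mod m (primeProd K)]
  ring

theorem table_step_dec_zero {r t t' : ℕ} (hq : q < Q) (hI : I q = .dec r t t') (hr : r < K)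
    (hm : ¬ Nat.nth Nat.Prime r ∣ m) (ht : 1 ≤ t') :
    (table Q K I).Step (Q * primeProd K) (Q * m + q) (Q * m + t') := by
  unfold AffineTable.Step table
  rw [residue_mod m hq, residue_div m hq, quotient_eq m hq, hI]
  -- The prime divides `primeProd K`, so the residue alone decides whether register `r` is zero.
  simp only [if_neg ((Nat.dvd_mod_iff (dvd_primeProd hr)).not.2 hm)]
  refine ⟨?_, trivial, by omega⟩
  conv_lhs => rw [← Nat.div_add_mod m (primeProd K)]
  ring

theorem table_step_dec_pos {r t t' : ℕ} (hq : q < Q) (hI : I q = .dec r t t') (hr : r < K)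
    (ht : 1 ≤ t) : (table Q K I).Step (Q * primeProd K)
      (Q * (Nat.nth Nat.Prime r * m) + q) (Q * m + t) := by
  have hp := (Nat.prime_nth_prime r).pos
  unfold AffineTable.Step table
  rw [residue_mod _ hq, residue_div _ hq, quotient_eq _ hq, hI]
  simp only [if_pos ((Nat.dvd_mod_iff (dvd_primeProd hr)).2 (dvd_mul_right _ m))]
  refine ⟨?_, trivial, by omega⟩
  obtain ⟨P', hP⟩ := dvd_primeProd hr
  rw [hP, Nat.mul_div_mul_left _ _ hp, Nat.mul_mod_mul_left, Nat.mul_div_cancel_left _ hp,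
    Nat.mul_div_cancel_left _ hp]
  conv_lhs => rw [← Nat.div_add_mod m P']
  ring

end Table

/-- The table of the flat form of a program simulates the program. -/
theorem Exec.reflTransGen {c : RegProg} {σ σ' : ℕ → ℕ} (h : Exec c σ σ') {Q K : ℕ}
    {I : ℕ → RegInstr} {s e : ℕ} (hK : c.bound ≤ K) (hs : 1 ≤ s) (he : 1 ≤ e)
    (hQ : s + c.size ≤ Q) (hI : ∀ q, s ≤ q → q < s + c.size → I q = c.code s e q) :
    Relation.ReflTransGen ((table Q K I).Step (Q * primeProd K))
      (Q * primeCode K σ + s) (Q * primeCode K σ' + e) := by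
  induction h generalizing s e with
  | skip σ =>
    simp only [size] at *
    exact .single (table_step_jump I _ (by omega) (hI s le_rfl (by omega)) he)
  | inc r σ =>
    simp only [size, bound] at *
    rw [primeCode_update_succ (by omega)]
    exact .single (table_step_inc I _ (by omega) (hI s le_rfl (by omega)) he)
  | @seq c d σ σ' σ'' _ _ ih1 ih2 =>
    simp only [size, bound] at *
    have h1 := c.size_pos
    have h2 := d.size_pos
    refine (ih1 (s := s) (e := s + c.size) (by omega) hs (by omega) (by omega) ?_).trans
      (ih2 (by omega) (by omega) he (by omega) ?_)
    · intro q hq1 hq2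
      rw [hI q hq1 (by omega), code, if_pos hq2]
    · intro q hq1 hq2
      rw [hI q (by omega) (by omega), code, if_neg (by omega)]
  | @loop_zero r c σ h0 =>
    simp only [size, bound] at *
    refine .single (table_step_dec_zero (r := r) (t := s + 1) I _ (by omega) ?_ (by omega)
      (not_dvd_primeCode h0) he)
    rw [hI s le_rfl (by omega), code, if_pos rfl]
  | @loop_succ r c σ σ' σ'' h0 _ _ ih1 ih2 =>
    have ih2 := ih2 hK hs he hQ hI
    simp only [size, bound] at *
    refine .head ?_ ((ih1 (s := s + 1) (e := s) (by omega) (by omega) hs (by omega) ?_).trans ih2)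
    · rw [← primeCode_update_pred (show r < K by omega) h0]
      refine table_step_dec_pos (t' := e) I _ (by omega) ?_ (by omega) (by omega)
      rw [hI s le_rfl (by omega), code, if_pos rfl]
    · intro q hq1 hq2
      rw [hI q (by omega) (by omega), code, if_neg (by omega)]

end RegProg

/-- Every partial recursive function is simulated by the iteration of a table, from a computable
initial value, with different halting behaviour for zero and nonzero values of the function. -/
theorem AffineTable.exists_simulation {f : ℕ →. ℕ} (hf : Nat.Partrec f) :
    ∃ (N : ℕ) (τ : AffineTable) (c : ℕ → ℕ), 0 < N ∧ Primrec c ∧ τ 0 = (0, 0, 1) ∧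
      ∀ z, ∀ y ∈ f z, ∃ n, Relation.ReflTransGen (τ.Step N) (c z) n ∧
        τ (n % N) = if y = 0 then (0, 1, 1) else (0, 0, 1) := by
  obtain ⟨e, rfl⟩ := Nat.Partrec.Code.exists_code.1 hf
  have hev : Primrec fun v : List.Vector ℕ 2 => Nat.Partrec.Code.evaln v.head e v.tail.head :=
    Nat.Partrec.Code.primrec_evaln.comp
      ((Primrec.vector_head.pair (.const e)).pair (Primrec.vector_head.comp Primrec.vector_tail))
  have hs : Nat.Primrec' fun v : List.Vector ℕ 2 =>
      bif (Nat.Partrec.Code.evaln v.head e v.tail.head).isSome then 0 else 1 :=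
    .of_prim (Primrec.cond (Primrec.option_isSome.comp hev) (.const 0) (.const 1))
  have hd : Nat.Primrec' fun v : List.Vector ℕ 2 =>
      (Nat.Partrec.Code.evaln v.head e v.tail.head).getD 0 :=
    .of_prim (Primrec.option_getD.comp hev (.const 0))
  obtain ⟨p, hp⟩ := RegProg.exists_exec_search hs hd
  let L := 1 + p.size
  -- Address 0 rejects, which gives `τ 0 = (0, 0, 1)`; `L` tests the output register 2, `L + 1`
  -- accepts and `L + 2` rejects.
  let I : ℕ → RegInstr := fun q =>
    if q = 0 then .halt false else if q < L then p.code 1 L q else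
    if q = L then .dec 2 (L + 2) (L + 1) else .halt (decide (q = L + 1))
  let Q := L + 3
  let K := max p.bound 3
  have hK : 3 ≤ K := le_max_right _ _
  -- The initial value stands for address 1 with `z` in register 0, whose prime is 2.
  refine ⟨Q * RegProg.primeProd K, RegProg.table Q K I, fun z => Q * 2 ^ z + 1,
    Nat.mul_pos (by omega) (RegProg.primeProd_pos K), ?_, ?_, ?_⟩
  · have h2 : Primrec₂ ((· ^ ·) : ℕ → ℕ → ℕ) := Primrec₂.unpaired'.1 Nat.Primrec.pow
    exact Primrec.nat_add.comp (Primrec.nat_mul.comp (.const _) (h2.comp (.const 2) .id)) (.const 1)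
  · simp [RegProg.table, I]
  · intro z y hy
    obtain ⟨k₀, hk₀⟩ := Nat.Partrec.Code.evaln_complete.1 hy
    have hex : ∃ k, (Nat.Partrec.Code.evaln k e z).isSome := ⟨k₀, by simp [Option.mem_def.1 hk₀]⟩
    classical
    obtain ⟨y', hy'⟩ := Option.isSome_iff_exists.1 (Nat.find_spec hex)
    have hyy : y' = y := Part.mem_unique (Nat.Partrec.Code.evaln_sound hy') hy
    subst hyy
    obtain ⟨σ', hσ, hout⟩ := hp z (Nat.find hex) (by simp [hy']) (by
      intro i hi
      have := Nat.find_min hex hi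
      simp [Option.not_isSome_iff_eq_none.1 this])
    have hrun := hσ.reflTransGen (Q := Q) (K := K) (I := I) (s := 1) (e := L) (le_max_left _ _)
      le_rfl (by omega) (by omega) (by
        intro q h1 h2
        simp only [I]
        rw [if_neg (by omega), if_pos h2])
    have hstart : RegProg.primeCode K (Function.update (fun _ => 0) 0 z) = 2 ^ z := by
      rw [RegProg.primeCode, Finset.prod_eq_single 0]
      · rw [Function.update_self, Nat.nth_prime_zero_eq_two]
      · intro i _ hi
        rw [Function.update_of_ne hi, pow_zero]
      · intro h
        exact absurd (Finset.mem_range.2 (by omega)) h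
    rw [hstart] at hrun
    have hIL : I L = .dec 2 (L + 2) (L + 1) := by
      simp only [I]
      rw [if_neg (by omega), if_neg (by omega), if_pos trivial]
    have hout : σ' 2 = y' := by simpa [hy'] using hout
    by_cases h0 : y' = 0
    · refine ⟨_, hrun.tail (RegProg.table_step_dec_zero I _ (by omega) hIL (by omega)
        (RegProg.not_dvd_primeCode (hout.trans h0)) (by omega)), ?_⟩
      have hIL1 : I (L + 1) = .halt true := by
        simp only [I]
        rw [if_neg (by omega), if_neg (by omega), if_neg (by omega)]
        simp
      rw [if_pos h0]
      simp only [RegProg.table]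
      rw [RegProg.residue_mod _ (by omega), hIL1]
    · rw [← RegProg.primeCode_update_pred (show 2 < K by omega) (by omega : σ' 2 ≠ 0)] at hrun
      refine ⟨_, hrun.tail (RegProg.table_step_dec_pos I _ (by omega) hIL (by omega) (by omega)),
        ?_⟩
      have hIL2 : I (L + 2) = .halt false := by
        simp only [I]
        rw [if_neg (by omega), if_neg (by omega), if_neg (by omega)]
        simp
      rw [if_neg h0]
      simp only [RegProg.table]
      rw [RegProg.residue_mod _ (by omega), hIL2]

/-! ### Languages generated by concrete grammars -/

/-- `Matches Q rhs w`: the word `w` results from `rhs` on replacing every nonterminal `X` by a word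
in `Q X`. -/
def Matches {A N : Type*} (Q : N → List A → Prop) : List (A ⊕ N) → List A → Prop
  | [], w => w = []
  | .inl a :: rhs, w => ∃ v, w = a :: v ∧ Matches Q rhs v
  | .inr X :: rhs, w => ∃ u v, w = u ++ v ∧ Q X u ∧ Matches Q rhs v

namespace Matches

variable {A N : Type*} {Q : N → List A → Prop}

theorem append_iff {p q : List (A ⊕ N)} {w : List A} :
    Matches Q (p ++ q) w ↔ ∃ u v, w = u ++ v ∧ Matches Q p u ∧ Matches Q q v := by
  induction p generalizing w with
  | nil => simp [Matches]
  | cons x p ih =>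
    rcases x with a | X
    · simp only [List.cons_append, Matches, ih]
      constructor
      · rintro ⟨_, rfl, u, v, rfl, h1, h2⟩
        exact ⟨a :: u, v, rfl, ⟨u, rfl, h1⟩, h2⟩
      · rintro ⟨_, v, rfl, ⟨u, rfl, h1⟩, h2⟩
        exact ⟨u ++ v, rfl, u, v, rfl, h1, h2⟩
    · simp only [List.cons_append, Matches, ih]
      constructor
      · rintro ⟨t, _, rfl, h, u, v, rfl, h1, h2⟩
        exact ⟨t ++ u, v, by simp, ⟨t, u, rfl, h, h1⟩, h2⟩
      · rintro ⟨_, v, rfl, ⟨t, u, rfl, h, h1⟩, h2⟩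
        exact ⟨t, u ++ v, by simp, h, u, v, rfl, h1, h2⟩

theorem map_inl_iff {u w : List A} : Matches Q (u.map Sum.inl) w ↔ w = u := by
  induction u generalizing w with
  | nil => simp [Matches]
  | cons a u ih => simp [Matches, ih]

end Matches

namespace GrammarCode

variable {k : ℕ}

/-- The symbol of a grammar that an element of the disjoint union stands for. -/
def toSymbol : Fin k ⊕ ℕ → Symbol (Fin k) ℕ := Sum.elim Symbol.terminal Symbol.nonterminal

/-- The inverse of `toSymbol`. -/
def ofSymbol : Symbol (Fin k) ℕ → Fin k ⊕ ℕ
  | .terminal a => .inl a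
  | .nonterminal X => .inr X

theorem ofSymbol_toSymbol (x : Fin k ⊕ ℕ) : ofSymbol (toSymbol x) = x := by
  rcases x with a | X <;> rfl

theorem mem_rules_iff {G : GrammarCode k} {r : ContextFreeRule (Fin k) ℕ} :
    r ∈ (toGrammar G).rules ↔ ∃ p ∈ G.2, toRule p = r := by
  simp [toGrammar]

theorem derives_of_matches {G : GrammarCode k} {rhs : List (Fin k ⊕ ℕ)} {w : List (Fin k)}
    (h : Matches (toGrammar G).GeneratesFrom rhs w) :
    (toGrammar G).Derives (rhs.map toSymbol) (w.map Symbol.terminal) := by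
  induction rhs generalizing w with
  | nil =>
    obtain rfl : w = [] := h
    exact Relation.ReflTransGen.refl
  | cons x rhs ih =>
    rcases x with a | X
    · obtain ⟨v, rfl, h⟩ := h
      exact (ih h).append_left [Symbol.terminal a]
    · obtain ⟨u, v, rfl, h1, h2⟩ := h
      rw [List.map_append]
      exact (h1.append_right (rhs.map toSymbol)).trans ((ih h2).append_left _)

theorem generatesFrom_of_matches {G : GrammarCode k} {X : ℕ} {rhs : List (Fin k ⊕ ℕ)}
    (hr : (X, rhs) ∈ G.2) {w : List (Fin k)} (h : Matches (toGrammar G).GeneratesFrom rhs w) :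
    (toGrammar G).GeneratesFrom X w := by
  have hp : (toGrammar G).Produces [Symbol.nonterminal X] (rhs.map toSymbol) :=
    ⟨toRule (X, rhs), mem_rules_iff.2 ⟨_, hr, rfl⟩, ContextFreeRule.Rewrites.input_output⟩
  exact hp.single.trans (derives_of_matches h)

/-- A family of languages that is closed under the productions contains the languages that the
nonterminals generate. -/
theorem of_generatesFrom {G : GrammarCode k} {Q : ℕ → List (Fin k) → Prop}
    (hQ : ∀ p ∈ G.2, ∀ w, Matches Q p.2 w → Q p.1 w) {X : ℕ} {w : List (Fin k)}
    (h : (toGrammar G).GeneratesFrom X w) : Q X w := by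
  -- Induction from the end of the derivation: with nonterminals read as languages in `Q`, every
  -- sentential form matches `w`; undoing one rewriting step uses closure once.
  have key : ∀ u, (toGrammar G).Derives u (w.map Symbol.terminal) →
      Matches Q (u.map ofSymbol) w := by
    intro u hu
    induction hu using Relation.ReflTransGen.head_induction_on with
    | refl =>
      rw [List.map_map]
      exact Matches.map_inl_iff.2 rfl
    | head hstep _ ih =>
      obtain ⟨r, hr, hrw⟩ := hstep
      obtain ⟨p, hp, rfl⟩ := mem_rules_iff.1 hr
      obtain ⟨s, t, rfl, rfl⟩ := hrw.exists_parts
      simp only [List.map_append] at ih ⊢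
      obtain ⟨_, v₃, rfl, h12, h3⟩ := Matches.append_iff.1 ih
      obtain ⟨v₁, v₂, rfl, h1, h2⟩ := Matches.append_iff.1 h12
      refine Matches.append_iff.2 ⟨_, _, rfl, Matches.append_iff.2 ⟨_, _, rfl, h1, ?_⟩, h3⟩
      refine ⟨v₂, [], by simp, hQ p hp _ ?_, rfl⟩
      have e : (toRule p).output.map ofSymbol = p.2 := by
        change (p.2.map toSymbol).map ofSymbol = p.2
        rw [List.map_map, funext (f := ofSymbol ∘ toSymbol) ofSymbol_toSymbol]
        exact List.map_id p.2
      rwa [e] at h2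
  obtain ⟨u, v, rfl, h1, rfl⟩ := key _ h
  rwa [List.append_nil]

/-! ### Grammars over two letters, lifted to larger alphabets -/

/-- The class of a letter: `true` for the first letter, and `false` for the others. -/
def letterClass (a : Fin k) : Bool := decide (a.val = 0)

/-- The symbols that a symbol over two letters is lifted to. -/
def liftSymbol (k : ℕ) (x : Bool ⊕ ℕ) : List (Fin k ⊕ ℕ) :=
  Sum.elim (fun b => ((List.finRange k).filter fun a => letterClass a == b).map Sum.inl)
    (fun X => [Sum.inr X]) x

/-- The productions that productions over two letters are lifted to. -/
def liftRules (k : ℕ) (R : List (ℕ × List (Bool ⊕ ℕ))) : List (ℕ × List (Fin k ⊕ ℕ)) :=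
  R.flatMap fun p => (p.2.map (liftSymbol k)).sections.map fun rhs => (p.1, rhs)

theorem inl_mem_liftSymbol {a : Fin k} {x : Bool ⊕ ℕ} :
    Sum.inl a ∈ liftSymbol k x ↔ x = Sum.inl (letterClass a) := by
  rcases x with b | X
  · simp [liftSymbol, eq_comm (a := b)]
  · simp [liftSymbol]

theorem inr_mem_liftSymbol {X : ℕ} {x : Bool ⊕ ℕ} :
    Sum.inr X ∈ liftSymbol k x ↔ x = Sum.inr X := by
  rcases x with b | Y
  · simp [liftSymbol]
  · simp [liftSymbol, eq_comm (a := X)]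

theorem mem_liftRules {R : List (ℕ × List (Bool ⊕ ℕ))} {X : ℕ} {rhs : List (Fin k ⊕ ℕ)} :
    (X, rhs) ∈ liftRules k R ↔
      ∃ rhs', (X, rhs') ∈ R ∧ List.Forall₂ (fun x y => x ∈ liftSymbol k y) rhs rhs' := by
  simp only [liftRules, List.mem_flatMap, List.mem_map, List.mem_sections, Prod.exists,
    Prod.mk.injEq, List.forall₂_map_right_iff]
  constructor
  · rintro ⟨_, rhs', h, rhs, h', rfl, rfl⟩
    exact ⟨rhs', h, h'⟩
  · rintro ⟨rhs', h, h'⟩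
    exact ⟨_, rhs', h, rhs, h', rfl, rfl⟩

/-- The match fixes how `w` splits, and each terminal can be lifted to the very letter of `w` at its
place, as all letters of its class are available. -/
theorem exists_lift_matches {P : ℕ → List (Fin k) → Prop} {rhs : List (Bool ⊕ ℕ)} {w : List (Fin k)}
    (h : Matches (fun X v => ∀ w : List (Fin k), w.map letterClass = v → P X w) rhs
      (w.map letterClass)) :
    ∃ rhs', List.Forall₂ (fun x y => x ∈ liftSymbol k y) rhs' rhs ∧ Matches P rhs' w := by
  induction rhs generalizing w with
  | nil => exact ⟨[], .nil, List.map_eq_nil_iff.1 h⟩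
  | cons x rhs ih =>
    rcases x with b | X
    · obtain ⟨v, hv, h⟩ := h
      obtain ⟨a, w, rfl, rfl, rfl⟩ := List.map_eq_cons_iff.1 hv
      obtain ⟨rhs', h1, h2⟩ := ih h
      exact ⟨.inl a :: rhs', .cons (inl_mem_liftSymbol.2 rfl) h1, w, rfl, h2⟩
    · obtain ⟨u, v, hv, hX, h⟩ := h
      obtain ⟨w₁, w₂, rfl, rfl, rfl⟩ := List.map_eq_append_iff.1 hv
      obtain ⟨rhs', h1, h2⟩ := ih h
      exact ⟨.inr X :: rhs', .cons (inr_mem_liftSymbol.2 rfl) h1, w₁, w₂, rfl, hX _ rfl, h2⟩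

theorem matches_of_lift {P : ℕ → List Bool → Prop} {rhs' : List (Fin k ⊕ ℕ)}
    {rhs : List (Bool ⊕ ℕ)} (hl : List.Forall₂ (fun x y => x ∈ liftSymbol k y) rhs' rhs)
    {w : List (Fin k)} (h : Matches (fun X w => P X (w.map letterClass)) rhs' w) :
    Matches P rhs (w.map letterClass) := by
  induction hl generalizing w with
  | nil =>
    obtain rfl : w = [] := h
    rfl
  | @cons x y _ _ hxy _ ih =>
    rcases x with a | X
    · obtain rfl := inl_mem_liftSymbol.1 hxy
      obtain ⟨v, rfl, h⟩ := h
      exact ⟨_, rfl, ih h⟩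
    · obtain rfl := inr_mem_liftSymbol.1 hxy
      obtain ⟨u, v, rfl, hX, h⟩ := h
      exact ⟨_, _, List.map_append, hX, ih h⟩

/-- The concrete grammar with the start symbol `0` and with the productions lifted from `R`. -/
def lift (k : ℕ) (R : List (ℕ × List (Bool ⊕ ℕ))) : GrammarCode k := (0, liftRules k R)

/-- The two-letter words all of whose lifts are generated form a family closed under `R`, so
completeness over two letters carries over to `Fin k`. -/
theorem lift_generates_of_matches {R : List (ℕ × List (Bool ⊕ ℕ))} {X : ℕ}
    {rhs : List (Bool ⊕ ℕ)} (hr : (X, rhs) ∈ R) {v : List Bool}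
    (h : Matches (fun X v => ∀ w : List (Fin k), w.map letterClass = v →
      (toGrammar (lift k R)).GeneratesFrom X w) rhs v) :
    ∀ w : List (Fin k), w.map letterClass = v → (toGrammar (lift k R)).GeneratesFrom X w := by
  rintro w rfl
  obtain ⟨rhs', h1, h2⟩ := exists_lift_matches h
  exact generatesFrom_of_matches (mem_liftRules.2 ⟨rhs, hr, h1⟩) h2

/-- Pulling `Q` back along `letterClass` gives a family closed under the lifted productions. -/
theorem of_lift_generates {R : List (ℕ × List (Bool ⊕ ℕ))} {Q : ℕ → List Bool → Prop}
    (hQ : ∀ p ∈ R, ∀ v, Matches Q p.2 v → Q p.1 v) {X : ℕ} {w : List (Fin k)}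
    (h : (toGrammar (lift k R)).GeneratesFrom X w) : Q X (w.map letterClass) := by
  refine of_generatesFrom (Q := fun X w => Q X (w.map letterClass)) ?_ h
  rintro ⟨X, rhs'⟩ hp w hw
  obtain ⟨rhs, hr, hl⟩ := mem_liftRules.1 hp
  exact hQ _ hr _ (matches_of_lift hl hw)

theorem lift_isProductive {R : List (ℕ × List (Bool ⊕ ℕ))}
    (hR : ∀ p ∈ R, ∃ b, Sum.inl b ∈ p.2) : (toGrammar (lift k R)).IsProductive := by
  intro r hr
  obtain ⟨⟨X, rhs'⟩, hp, rfl⟩ := mem_rules_iff.1 hr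
  obtain ⟨rhs, hr, hl⟩ := mem_liftRules.1 hp
  obtain ⟨b, hb⟩ : ∃ b, Sum.inl b ∈ rhs := hR _ hr
  have : ∃ a : Fin k, Sum.inl a ∈ rhs' := by
    clear * - hl hb
    induction hl with
    | nil => simp at hb
    | @cons x y _ _ hxy _ ih =>
      rcases List.mem_cons.1 hb with rfl | hb
      · rcases x with a | X
        · exact ⟨a, List.mem_cons_self⟩
        · simp [inr_mem_liftSymbol] at hxy
      · obtain ⟨a, ha⟩ := ih hb
        exact ⟨a, List.mem_cons_of_mem _ ha⟩
  obtain ⟨a, ha⟩ := this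
  exact ⟨a, List.mem_map.2 ⟨_, ha, rfl⟩⟩

theorem exists_letterClass (hk : 2 ≤ k) (v : List Bool) :
    ∃ w : List (Fin k), w.map letterClass = v := by
  refine ⟨v.map fun b => if b then ⟨0, by omega⟩ else ⟨1, by omega⟩, ?_⟩
  rw [List.map_map]
  refine List.map_id'' ?_ v
  intro b
  cases b <;> simp [letterClass]

theorem primrec_sections {α β : Type*} [Primcodable α] [Primcodable β] {f : α → List (List β)}
    (hf : Primrec f) : Primrec fun a => (f a).sections := by
  refine (Primrec.list_foldr (σ := List (List β)) (h := fun _ p => p.2.flatMap fun s =>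
    p.1.map fun x => x :: s) hf (.const [[]]) ?_).of_eq fun a => ?_
  · refine Primrec.list_flatMap (Primrec.snd.comp .snd) ?_
    exact Primrec.list_map (Primrec.fst.comp (Primrec.snd.comp .fst))
      (Primrec.list_cons.comp .snd (Primrec.snd.comp .fst))
  · induction f a with
    | nil => rfl
    | cons l L ih => rw [List.foldr_cons, ih]; rfl

theorem primrec_liftRules : Primrec (liftRules k) := by
  have hs : Primrec (liftSymbol k) := by
    refine (Primrec.sumCasesOn (f := id)
      (g := fun _ b => ((List.finRange k).filter fun a => letterClass a == b).map Sum.inl)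
      (h := fun _ X => [(Sum.inr X : Fin k ⊕ ℕ)]) .id ?_ ?_).of_eq ?_
    · exact (Primrec.dom_finite fun b : Bool =>
        ((List.finRange k).filter fun a => letterClass a == b).map
          (Sum.inl : Fin k → Fin k ⊕ ℕ)).comp .snd
    · exact Primrec.list_cons.comp (Primrec.sumInr.comp .snd) (.const [])
    · rintro (b | X) <;> rfl
  refine Primrec.list_flatMap .id ?_
  refine Primrec.list_map (primrec_sections ?_) ?_
  · exact Primrec.list_map (Primrec.snd.comp .snd) (hs.comp .snd)
  · exact Primrec.pair (Primrec.fst.comp (Primrec.snd.comp .fst)) .snd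

end GrammarCode

/-! ### The grammar of the words that are not histories -/

namespace AffineTable

/-- The least value that may follow `n`. -/
def low (τ : AffineTable) (N n : ℕ) : ℕ := (τ (n % N)).1 * (n / N) + (τ (n % N)).2.1

/-- A strict upper bound of the values that may follow `n`. -/
def high (τ : AffineTable) (N n : ℕ) : ℕ := (τ (n % N)).1 * (n / N) + (τ (n % N)).2.2

/-- A word of `n` ticks. -/
abbrev ticks (n : ℕ) : List Bool := List.replicate n true

/-- `n` ticks as symbols of a grammar. -/
abbrev tickSymbols (n : ℕ) : List (Bool ⊕ ℕ) := (ticks n).map Sum.inl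

/-- Productions for the start symbol `0`, the nonterminal `1` of all nonempty words, and the
nonterminals `2` and `3` of words with a violation. -/
def bitRules (b : Bool) : List (ℕ × List (Bool ⊕ ℕ)) :=
  [(1, [.inl b]), (1, [.inl b, .inr 1]), (0, [.inl b, .inr 2, .inr 1]), (0, [.inl b, .inr 2]),
    (0, [.inl b]), (0, [.inr 1, .inl true, .inl b]), (2, [.inl b, .inr 3]), (3, [.inl b, .inr 3])]

/-- Productions for words of length two or three, and for longer words whose third letter from the
end is a tick. -/
def endRules (b₁ b₂ b₃ : Bool) : List (ℕ × List (Bool ⊕ ℕ)) :=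
  [(0, [.inl b₁, .inl b₂]), (0, [.inl b₁, .inl b₂, .inl b₃]),
    (0, [.inr 1, .inl true, .inl b₂, .inl b₃])]

/-- Productions for pairs of consecutive blocks with lengths against the table. -/
def residueRules (τ : AffineTable) (N r : ℕ) : List (ℕ × List (Bool ⊕ ℕ)) :=
  [(2, [.inl false, .inr (2 * r + 4), .inr 1]),
    (2, [.inl false, .inr (2 * r + 5), .inl false, .inr 1]),
    (3, [.inl false, .inr (2 * r + 4), .inr 1]),
    (3, [.inl false, .inr (2 * r + 5), .inl false, .inr 1]),
    (2 * r + 4, tickSymbols N ++ .inr (2 * r + 4) :: tickSymbols (τ r).1),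
    (2 * r + 4, tickSymbols r ++ .inl false :: tickSymbols (τ r).2.2)] ++
  (List.range ((τ r).1 + 1)).map (fun i =>
    (2 * r + 5, tickSymbols N ++ .inr (2 * r + 5) :: tickSymbols i)) ++
  (List.range (τ r).2.1).map fun i =>
    (2 * r + 5, tickSymbols r ++ .inl false :: tickSymbols i)

/-- Productions for words that do not start with a block of length `c`. -/
def initialRules (c : ℕ) : List (ℕ × List (Bool ⊕ ℕ)) :=
  (2, .inl false :: ((List.range (c + 1)).map (fun _ => .inl true) ++ [.inr 1])) ::
  (List.range c).map fun j =>
    (2, .inl false :: ((List.range j).map (fun _ => .inl true) ++ [.inl false, .inr 1]))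

/-- All the productions that do not depend on the initial value. -/
def transitionRules (τ : AffineTable) (N : ℕ) : List (ℕ × List (Bool ⊕ ℕ)) :=
  [true, false].flatMap bitRules ++
  [true, false].flatMap (fun b₁ => [true, false].flatMap fun b₂ =>
    [true, false].flatMap fun b₃ => endRules b₁ b₂ b₃) ++
  (2, [.inl true, .inr 1]) :: (List.range N).flatMap fun r => residueRules τ N r

/-- The productions for the iteration of the table `τ` from `c`. -/
def historyRules (τ : AffineTable) (N c : ℕ) : List (ℕ × List (Bool ⊕ ℕ)) :=
  initialRules c ++ transitionRules τ N

theorem mem_historyRules {τ : AffineTable} {N c : ℕ} {p : ℕ × List (Bool ⊕ ℕ)} :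
    p ∈ historyRules τ N c ↔ p ∈ initialRules c ∨ (∃ b, p ∈ bitRules b) ∨
      (∃ b₁ b₂ b₃, p ∈ endRules b₁ b₂ b₃) ∨ p = (2, [.inl true, .inr 1]) ∨
      ∃ r < N, p ∈ residueRules τ N r := by
  simp only [historyRules, transitionRules, List.mem_append, List.mem_cons, List.mem_flatMap,
    List.mem_range, Bool.exists_bool, List.not_mem_nil, or_false, exists_eq_or_imp, exists_eq_left]
  tauto

theorem map_range_inl_true (n : ℕ) :
    (List.range n).map (fun _ => (.inl true : Bool ⊕ ℕ)) = (ticks n).map .inl := by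
  simp

theorem historyRules_isProductive {τ : AffineTable} {N : ℕ} (hN : 0 < N) (c : ℕ) :
    ∀ p ∈ historyRules τ N c, ∃ b, Sum.inl b ∈ p.2 := by
  intro p hp
  rcases mem_historyRules.1 hp with h | ⟨b, h⟩ | ⟨b₁, b₂, b₃, h⟩ | rfl | ⟨r, -, h⟩
  · simp only [initialRules, List.mem_cons, List.mem_map] at h
    rcases h with rfl | ⟨j, -, rfl⟩ <;> exact ⟨false, List.mem_cons_self⟩
  · refine ⟨b, ?_⟩
    simp only [bitRules, List.mem_cons, List.not_mem_nil, or_false] at h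
    rcases h with rfl | rfl | rfl | rfl | rfl | rfl | rfl | rfl <;> simp
  · refine ⟨if p.2.length = 2 then b₁ else b₃, ?_⟩
    simp only [endRules, List.mem_cons, List.not_mem_nil, or_false] at h
    rcases h with rfl | rfl | rfl <;> simp
  · exact ⟨true, List.mem_cons_self⟩
  · simp only [residueRules, List.mem_append, List.mem_cons, List.not_mem_nil, or_false,
      List.mem_map] at h
    rcases h with ((rfl | rfl | rfl | rfl | rfl | rfl) | ⟨i, -, rfl⟩) | ⟨i, -, rfl⟩
    · exact ⟨false, by simp⟩
    · exact ⟨false, by simp⟩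
    · exact ⟨false, by simp⟩
    · exact ⟨false, by simp⟩
    · exact ⟨true, by simp; omega⟩
    · exact ⟨false, by simp⟩
    · exact ⟨true, by simp; omega⟩
    · exact ⟨false, by simp⟩

/-! ### Words of ticks and separators -/

theorem exists_eq_ticks_append (v : List Bool) :
    ∃ i, v = ticks i ∨ ∃ y, v = ticks i ++ false :: y := by
  induction v with
  | nil => exact ⟨0, .inl rfl⟩
  | cons b v ih =>
    cases b with
    | false => exact ⟨0, .inr ⟨v, rfl⟩⟩
    | true =>
      obtain ⟨i, rfl | ⟨y, rfl⟩⟩ := ih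
      · exact ⟨i + 1, .inl rfl⟩
      · exact ⟨i + 1, .inr ⟨y, rfl⟩⟩

theorem ticks_add (m n : ℕ) : ticks (m + n) = ticks m ++ ticks n :=
  List.replicate_add m n true

/-- On the right, the `n` ticks are a maximal run. -/
theorem le_of_ticks_append_eq {m n : ℕ} {x y : List Bool} (h : ticks m ++ x = ticks n ++ y)
    (hy : y.head? ≠ some true) : m ≤ n := by
  induction m generalizing n with
  | zero => exact Nat.zero_le _
  | succ m ih =>
    cases n with
    | zero =>
      simp only [ticks, List.replicate_zero, List.nil_append] at h
      subst h
      simp [List.replicate_succ] at hy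
    | succ n =>
      simp only [ticks, List.replicate_succ, List.cons_append, List.cons.injEq, true_and] at h
      exact Nat.succ_le_succ (ih h)

theorem ticks_append_cons_inj {m n : ℕ} {x y : List Bool}
    (h : ticks m ++ false :: x = ticks n ++ false :: y) : m = n ∧ x = y := by
  obtain rfl : m = n := le_antisymm (le_of_ticks_append_eq h (by simp))
    (le_of_ticks_append_eq h.symm (by simp))
  simpa using h

theorem suffix_of_suffix_ticks_append {n : ℕ} {s x : List Bool}
    (h : false :: s <:+ ticks n ++ x) : false :: s <:+ x := by
  induction n with
  | zero => simpa using h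
  | succ n ih =>
    rw [ticks, List.replicate_succ, List.cons_append, List.suffix_cons_iff] at h
    rcases h with h | h
    · simp at h
    · exact ih h

/-- In the word `h`, every two consecutive blocks respect the table. -/
def Lawful (τ : AffineTable) (N : ℕ) (h : List Bool) : Prop :=
  ∀ n j y, false :: (ticks n ++ false :: (ticks j ++ y)) <:+ h →
    j < τ.high N n ∧ (y.head? = some false → τ.low N n ≤ j)

theorem lawful_singleton (τ : AffineTable) (N : ℕ) : τ.Lawful N [false] := by
  intro n j y h
  have := h.length_le
  simp at this

/-- A suffix that starts with a separator is the whole word or starts at a later separator, where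
`h` applies. The condition on `x` makes the block of length `j` maximal, so that cut-off readings of
it are only shorter and keep the upper bound. -/
theorem Lawful.cons {τ : AffineTable} {N n j : ℕ} {x : List Bool}
    (h : τ.Lawful N (false :: (ticks j ++ x))) (hlow : τ.low N n ≤ j) (hhigh : j < τ.high N n)
    (hx : x.head? ≠ some true) :
    τ.Lawful N (false :: (ticks n ++ false :: (ticks j ++ x))) := by
  intro n' j' y hs
  rcases List.suffix_cons_iff.1 hs with hs | hs
  · simp only [List.cons.injEq, true_and] at hs
    obtain ⟨rfl, he⟩ := ticks_append_cons_inj hs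
    refine ⟨(le_of_ticks_append_eq he hx).trans_lt hhigh, fun hy => hlow.trans ?_⟩
    exact le_of_ticks_append_eq he.symm (by simp [hy])
  · exact h n' j' y (suffix_of_suffix_ticks_append hs)

/-- A computation that ends by rejecting has a lawful history that ends with three separators. -/
theorem exists_lawful {τ : AffineTable} {N c n : ℕ} (h0 : τ 0 = (0, 0, 1))
    (h : Relation.ReflTransGen (τ.Step N) c n) (hn : τ (n % N) = (0, 0, 1)) :
    ∃ x, τ.Lawful N (false :: (ticks c ++ x)) ∧ x.head? = some false ∧
      ∃ z, x = z ++ [false, false, false] := by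
  have hl : ∀ m, τ (m % N) = (0, 0, 1) → τ.low N m = 0 ∧ τ.high N m = 1 := fun m hm => by
    simp [low, high, hm]
  have hz := hl 0 (by rwa [Nat.zero_mod])
  induction h using Relation.ReflTransGen.head_induction_on with
  | refl =>
    -- The rejecting number may be followed by 0, and 0 by 0; the empty blocks leave three
    -- separators at the end.
    have h1 : τ.Lawful N (false :: (ticks 0 ++ [])) := lawful_singleton τ N
    have h2 := h1.cons (n := 0) (by omega) (by omega) (by simp)
    have h3 := Lawful.cons (j := 0) (x := [false]) (n := 0) h2 (by omega) (by omega) (by simp)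
    have hn := hl n hn
    have h4 := Lawful.cons (j := 0) (x := [false, false]) (n := n) h3 (by omega) (by omega)
      (by simp)
    exact ⟨_, h4, rfl, [], rfl⟩
  | @head m m' hstep _ ih =>
    obtain ⟨x, hx, hx0, z, rfl⟩ := ih
    obtain ⟨h1, h2, h3⟩ := hstep
    exact ⟨_, hx.cons (n := m) (by rw [low]; omega) (by rw [high]; omega) (by simp [hx0]), rfl,
      false :: (ticks m' ++ z), by simp⟩

/-- The family `Q` of languages is closed under the productions in `R`. -/
def IsClosed (R : List (ℕ × List (Bool ⊕ ℕ))) (Q : ℕ → List Bool → Prop) : Prop :=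
  ∀ p ∈ R, ∀ v, Matches Q p.2 v → Q p.1 v

/-! ### Soundness -/

theorem matches_ticks_append {Q : ℕ → List Bool → Prop} {n : ℕ} {rhs : List (Bool ⊕ ℕ)}
    {w : List Bool} :
    Matches Q ((ticks n).map .inl ++ rhs) w ↔ ∃ v, w = ticks n ++ v ∧ Matches Q rhs v := by
  rw [Matches.append_iff]
  simp only [Matches.map_inl_iff]
  exact ⟨fun ⟨_, v, hw, rfl, hv⟩ => ⟨v, hw, hv⟩, fun ⟨v, hw, hv⟩ => ⟨_, v, hw, rfl, hv⟩⟩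

theorem matches_ticks {Q : ℕ → List Bool → Prop} {n : ℕ} {w : List Bool} :
    Matches Q ((ticks n).map .inl) w ↔ w = ticks n := Matches.map_inl_iff

/-- Languages that are closed under the productions, if `h` is a lawful history. -/
def Sound (τ : AffineTable) (N : ℕ) (h : List Bool) (X : ℕ) (v : List Bool) : Prop :=
  (X = 0 → ∀ b, v ≠ b :: h) ∧ (X = 2 → ¬ v <+: h) ∧ (X = 3 → ¬ v <:+: h) ∧
  (∀ r, X = 2 * r + 4 → ∃ t, v = ticks (N * t + r) ++ false :: ticks ((τ r).1 * t + (τ r).2.2)) ∧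
  (∀ r, X = 2 * r + 5 → ∃ t j, v = ticks (N * t + r) ++ false :: ticks j ∧
    j < (τ r).1 * t + (τ r).2.1)

theorem sound_of_lt {τ : AffineTable} {N : ℕ} {h : List Bool} {X : ℕ} {v : List Bool}
    (h0 : X = 0 → ∀ b, v ≠ b :: h) (h2 : X = 2 → ¬ v <+: h) (h3 : X = 3 → ¬ v <:+: h)
    (h4 : X < 4) : τ.Sound N h X v :=
  ⟨h0, h2, h3, fun r hr => by omega, fun r hr => by omega⟩

section Soundness

variable {τ : AffineTable} {N c : ℕ} {h : List Bool}

/-- The second block already has too many ticks, however the word goes on. -/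
theorem not_infix_of_over (hh : τ.Lawful N h) {r : ℕ} (hr : r < N) {v : List Bool}
    (hv : Matches (τ.Sound N h) [.inl false, .inr (2 * r + 4), .inr 1] v) : ¬ v <:+: h := by
  obtain ⟨_, rfl, u, _, rfl, hu, v, _, rfl, -, rfl⟩ := hv
  obtain ⟨t, rfl⟩ := hu.2.2.2.1 r rfl
  intro hi
  obtain ⟨s, ⟨z, rfl⟩, hs⟩ := List.infix_iff_prefix_suffix.1 hi
  have := (hh (N * t + r) ((τ r).1 * t + (τ r).2.2) (v ++ z) (by simpa using hs)).1
  rw [high, Nat.mul_add_mod, Nat.mod_eq_of_lt hr, Nat.mul_add_div (by omega),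
    Nat.div_eq_of_lt hr, add_zero] at this
  omega

/-- The separator after the second block is essential: otherwise the block might go on and reach its
lower bound. -/
theorem not_infix_of_under (hh : τ.Lawful N h) {r : ℕ} (hr : r < N) {v : List Bool}
    (hv : Matches (τ.Sound N h) [.inl false, .inr (2 * r + 5), .inl false, .inr 1] v) :
    ¬ v <:+: h := by
  obtain ⟨_, rfl, u, _, rfl, hu, _, rfl, v, _, rfl, -, rfl⟩ := hv
  obtain ⟨t, j, rfl, hj⟩ := hu.2.2.2.2 r rfl
  intro hi
  obtain ⟨s, ⟨z, rfl⟩, hs⟩ := List.infix_iff_prefix_suffix.1 hi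
  have := (hh (N * t + r) j (false :: (v ++ z)) (by simpa using hs)).2 rfl
  rw [low, Nat.mul_add_mod, Nat.mod_eq_of_lt hr, Nat.mul_add_div (by omega),
    Nat.div_eq_of_lt hr, add_zero] at this
  omega

theorem sound_residueRules (hh : τ.Lawful N h) {r : ℕ} (hr : r < N) :
    IsClosed (residueRules τ N r) (τ.Sound N h) := by
  intro p hp v hv
  simp only [residueRules, List.mem_append, List.mem_cons, List.not_mem_nil, or_false,
    List.mem_map, List.mem_range] at hp
  rcases hp with ((rfl | rfl | rfl | rfl | rfl | rfl) | ⟨i, hi, rfl⟩) | ⟨i, hi, rfl⟩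
  · exact sound_of_lt (by simp) (fun _ hp => not_infix_of_over hh hr hv hp.isInfix) (by simp)
      (by omega)
  · exact sound_of_lt (by simp) (fun _ hp => not_infix_of_under hh hr hv hp.isInfix) (by simp)
      (by omega)
  · exact sound_of_lt (by simp) (by simp) (fun _ => not_infix_of_over hh hr hv) (by omega)
  · exact sound_of_lt (by simp) (by simp) (fun _ => not_infix_of_under hh hr hv) (by omega)
  · obtain ⟨_, rfl, u, w, rfl, hu, hw⟩ := matches_ticks_append.1 hv
    obtain rfl := matches_ticks.1 hw
    obtain ⟨t, rfl⟩ := hu.2.2.2.1 r rfl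
    refine ⟨fun hX => by omega, fun hX => by omega, fun hX => by omega, fun r' hX => ?_,
      fun r' hX => by omega⟩
    obtain rfl : r = r' := by omega
    refine ⟨t + 1, ?_⟩
    rw [show N * (t + 1) + r = N + (N * t + r) by ring,
      show (τ r).1 * (t + 1) + (τ r).2.2 = (τ r).1 * t + (τ r).2.2 + (τ r).1 by ring,
      ticks_add N, ticks_add (_ + (τ r).2.2)]
    simp only [List.append_assoc, List.cons_append]
  · obtain ⟨_, rfl, u, rfl, hu⟩ := matches_ticks_append.1 hv
    obtain rfl := matches_ticks.1 hu
    refine ⟨fun hX => by omega, fun hX => by omega, fun hX => by omega, fun r' hX => ?_,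
      fun r' hX => by omega⟩
    obtain rfl : r = r' := by omega
    exact ⟨0, by simp⟩
  · obtain ⟨_, rfl, u, w, rfl, hu, hw⟩ := matches_ticks_append.1 hv
    obtain rfl := matches_ticks.1 hw
    obtain ⟨t, j, rfl, hj⟩ := hu.2.2.2.2 r rfl
    refine ⟨fun hX => by omega, fun hX => by omega, fun hX => by omega, fun r' hX => by omega,
      fun r' hX => ?_⟩
    obtain rfl : r = r' := by omega
    refine ⟨t + 1, j + i, ?_, by rw [Nat.mul_succ]; omega⟩
    rw [show N * (t + 1) + r = N + (N * t + r) by ring, ticks_add N, ticks_add j]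
    simp only [List.append_assoc, List.cons_append]
  · obtain ⟨_, rfl, u, rfl, hu⟩ := matches_ticks_append.1 hv
    obtain rfl := matches_ticks.1 hu
    refine ⟨fun hX => by omega, fun hX => by omega, fun hX => by omega, fun r' hX => by omega,
      fun r' hX => ?_⟩
    obtain rfl : r = r' := by omega
    exact ⟨0, i, by simp, by simpa using hi⟩

theorem sound_initialRules {x : List Bool} (hx : x.head? = some false)
    (he : h = false :: (ticks c ++ x)) :
    IsClosed (initialRules c) (τ.Sound N h) := by
  intro p hp v hv
  simp only [initialRules, List.mem_cons, List.mem_map, List.mem_range, map_range_inl_true] at hp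
  rcases hp with rfl | ⟨j, hj, rfl⟩
  · refine sound_of_lt (by simp) (fun _ hp => ?_) (by simp) (by omega)
    obtain ⟨_, rfl, h1⟩ := hv
    obtain ⟨v, rfl, -⟩ := matches_ticks_append.1 h1
    obtain ⟨z, hz⟩ := hp
    rw [he, List.cons_append, List.append_assoc, List.cons.injEq] at hz
    have := le_of_ticks_append_eq hz.2 (by simp [hx])
    omega
  · refine sound_of_lt (by simp) (fun _ hp => ?_) (by simp) (by omega)
    obtain ⟨_, rfl, h1⟩ := hv
    obtain ⟨_, rfl, v, rfl, -⟩ := matches_ticks_append.1 h1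
    obtain ⟨z, hz⟩ := hp
    rw [he, List.cons_append, List.append_assoc, List.cons.injEq, List.cons_append] at hz
    have := le_of_ticks_append_eq hz.2.symm (by simp)
    omega

/-- Productions of the start symbol through 2 cannot give `b :: h`, as no word of 2 is a prefix of
`h`; the one with a penultimate tick cannot, as `h` ends in separators. -/
theorem sound_bitRules {x : List Bool} (he : h = x ++ [false, false, false]) (b : Bool) :
    IsClosed (bitRules b) (τ.Sound N h) := by
  intro p hp v hv
  simp only [bitRules, List.mem_cons, List.not_mem_nil, or_false] at hp
  rcases hp with rfl | rfl | rfl | rfl | rfl | rfl | rfl | rfl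
  · exact sound_of_lt (by simp) (by simp) (by simp) (by omega)
  · exact sound_of_lt (by simp) (by simp) (by simp) (by omega)
  · refine sound_of_lt (fun _ b' e => ?_) (by simp) (by simp) (by omega)
    obtain ⟨_, rfl, u, w, rfl, hu, -⟩ := hv
    rw [List.cons.injEq] at e
    exact hu.2.1 rfl ⟨w, e.2⟩
  · refine sound_of_lt (fun _ b' e => ?_) (by simp) (by simp) (by omega)
    obtain ⟨_, rfl, u, w, rfl, hu, -⟩ := hv
    rw [List.cons.injEq] at e
    exact hu.2.1 rfl ⟨w, e.2⟩
  · refine sound_of_lt (fun _ b' e => ?_) (by simp) (by simp) (by omega)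
    obtain ⟨_, rfl, rfl⟩ := hv
    simp [he] at e
  · refine sound_of_lt (fun _ b' e => ?_) (by simp) (by simp) (by omega)
    obtain ⟨u, _, rfl, -, _, rfl, _, rfl, rfl⟩ := hv
    rw [he, show b' :: (x ++ [false, false, false]) = (b' :: x ++ [false]) ++ [false, false] by
      simp] at e
    have := (List.append_inj' e rfl).2
    simp at this
  · refine sound_of_lt (by simp) (fun _ hp => ?_) (by simp) (by omega)
    obtain ⟨_, rfl, u, _, rfl, hu, rfl⟩ := hv
    rw [List.append_nil] at hp
    exact hu.2.2.1 rfl ((List.suffix_cons b u).isInfix.trans hp.isInfix)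
  · refine sound_of_lt (by simp) (by simp) (fun _ hp => ?_) (by omega)
    obtain ⟨_, rfl, u, _, rfl, hu, rfl⟩ := hv
    rw [List.append_nil] at hp
    exact hu.2.2.1 rfl ((List.suffix_cons b u).isInfix.trans hp)

theorem sound_endRules {x : List Bool} (he : h = x ++ [false, false, false]) (b₁ b₂ b₃ : Bool) :
    IsClosed (endRules b₁ b₂ b₃) (τ.Sound N h) := by
  intro p hp v hv
  simp only [endRules, List.mem_cons, List.not_mem_nil, or_false] at hp
  rcases hp with rfl | rfl | rfl
  · refine sound_of_lt (fun _ b' e => ?_) (by simp) (by simp) (by omega)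
    obtain ⟨_, rfl, _, rfl, rfl⟩ := hv
    simpa [he] using congrArg List.length e
  · refine sound_of_lt (fun _ b' e => ?_) (by simp) (by simp) (by omega)
    obtain ⟨_, rfl, _, rfl, _, rfl, rfl⟩ := hv
    simpa [he] using congrArg List.length e
  · refine sound_of_lt (fun _ b' e => ?_) (by simp) (by simp) (by omega)
    obtain ⟨u, _, rfl, -, _, rfl, _, rfl, _, rfl, rfl⟩ := hv
    rw [he, ← List.cons_append] at e
    have := (List.append_inj' e rfl).2
    simp at this

/-- If the iteration rejects, there is a word that the start symbol does not generate, together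
with languages that are closed under the productions. -/
theorem exists_sound {n : ℕ} (h0 : τ 0 = (0, 0, 1))
    (hrun : Relation.ReflTransGen (τ.Step N) c n) (hn : τ (n % N) = (0, 0, 1)) :
    ∃ Q : ℕ → List Bool → Prop,
      IsClosed (historyRules τ N c) Q ∧ ∃ v, v ≠ [] ∧ ¬ Q 0 v := by
  obtain ⟨x, hl, hx, z, rfl⟩ := exists_lawful h0 hrun hn
  -- The front letter `true` is an arbitrary choice: `Sound` excludes the history behind any letter.
  refine ⟨τ.Sound N _, ?_, true :: false :: (ticks c ++ (z ++ [false, false, false])), by simp,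
    fun hs => hs.1 rfl true rfl⟩
  have he : false :: (ticks c ++ (z ++ [false, false, false])) =
      (false :: (ticks c ++ z)) ++ [false, false, false] := by simp
  intro p hp
  rcases mem_historyRules.1 hp with h | ⟨b, h⟩ | ⟨b₁, b₂, b₃, h⟩ | rfl | ⟨r, hr, h⟩
  · exact sound_initialRules hx rfl p h
  · exact sound_bitRules he b p h
  · exact sound_endRules he b₁ b₂ b₃ p h
  · rintro v ⟨v, rfl, -⟩
    exact sound_of_lt (by simp) (by simp) (by simp) (by omega)
  · exact sound_residueRules hl hr p h

end Soundness

/-! ### Completeness -/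

section Completeness

variable {τ : AffineTable} {N c : ℕ} {Q : ℕ → List Bool → Prop}

namespace IsClosed

theorem of_bitRules (hQ : IsClosed (historyRules τ N c) Q) {b : Bool} {X : ℕ}
    {rhs : List (Bool ⊕ ℕ)} (h : (X, rhs) ∈ bitRules b) {v : List Bool} (hv : Matches Q rhs v) :
    Q X v :=
  hQ _ (mem_historyRules.2 (.inr (.inl ⟨b, h⟩))) v hv

theorem of_endRules (hQ : IsClosed (historyRules τ N c) Q) {b₁ b₂ b₃ : Bool} {X : ℕ}
    {rhs : List (Bool ⊕ ℕ)} (h : (X, rhs) ∈ endRules b₁ b₂ b₃) {v : List Bool}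
    (hv : Matches Q rhs v) : Q X v :=
  hQ _ (mem_historyRules.2 (.inr (.inr (.inl ⟨b₁, b₂, b₃, h⟩)))) v hv

theorem of_residueRules (hQ : IsClosed (historyRules τ N c) Q) {r : ℕ} (hr : r < N) {X : ℕ}
    {rhs : List (Bool ⊕ ℕ)} (h : (X, rhs) ∈ residueRules τ N r) {v : List Bool}
    (hv : Matches Q rhs v) : Q X v :=
  hQ _ (mem_historyRules.2 (.inr (.inr (.inr (.inr ⟨r, hr, h⟩))))) v hv

theorem one (hQ : IsClosed (historyRules τ N c) Q) {v : List Bool} (hv : v ≠ []) : Q 1 v := by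
  induction v with
  | nil => exact absurd rfl hv
  | cons b v ih =>
    rcases eq_or_ne v [] with rfl | h
    · exact hQ.of_bitRules (b := b) (rhs := [.inl b]) (by simp [bitRules]) ⟨[], rfl, rfl⟩
    · exact hQ.of_bitRules (b := b) (rhs := [.inl b, .inr 1]) (by simp [bitRules])
        ⟨v, rfl, v, [], by simp, ih h, rfl⟩

theorem generates_over (hQ : IsClosed (historyRules τ N c) Q) {r : ℕ} (hr : r < N) (t : ℕ) :
    Q (2 * r + 4) (ticks (N * t + r) ++ false :: ticks ((τ r).1 * t + (τ r).2.2)) := by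
  induction t with
  | zero =>
    refine hQ.of_residueRules hr (rhs := tickSymbols r ++ .inl false :: tickSymbols (τ r).2.2)
      (by simp [residueRules]) (matches_ticks_append.2 ⟨_, ?_, _, rfl, matches_ticks.2 rfl⟩)
    simp
  | succ t ih =>
    refine hQ.of_residueRules hr
      (rhs := tickSymbols N ++ .inr (2 * r + 4) :: tickSymbols (τ r).1)
      (by simp [residueRules])
      (matches_ticks_append.2 ⟨_, ?_, _, _, rfl, ih, matches_ticks.2 rfl⟩)
    rw [show N * (t + 1) + r = N + (N * t + r) by ring,
      show (τ r).1 * (t + 1) + (τ r).2.2 = (τ r).1 * t + (τ r).2.2 + (τ r).1 by ring,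
      ticks_add N, ticks_add (_ + (τ r).2.2)]
    simp only [List.append_assoc, List.cons_append]

/-- Each of `t` rounds adds between 0 and `a` ticks to a start below `l`, which reaches every number
below `a * t + l`. With `l = 0` the recursion would have no base. -/
theorem generates_under (hQ : IsClosed (historyRules τ N c) Q) {r : ℕ} (hr : r < N)
    (hl : 1 ≤ (τ r).2.1) (t j : ℕ) (hj : j < (τ r).1 * t + (τ r).2.1) :
    Q (2 * r + 5) (ticks (N * t + r) ++ false :: ticks j) := by
  induction t generalizing j with
  | zero =>
    refine hQ.of_residueRules hr (rhs := tickSymbols r ++ .inl false :: tickSymbols j)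
      ?_ (matches_ticks_append.2 ⟨_, ?_, _, rfl, matches_ticks.2 rfl⟩)
    · refine List.mem_append_right _ (List.mem_map.2 ⟨j, List.mem_range.2 ?_, rfl⟩)
      simpa using hj
    · simp
  | succ t ih =>
    obtain ⟨i, j, hi, hj', rfl⟩ : ∃ i j', i < (τ r).1 + 1 ∧ j' < (τ r).1 * t + (τ r).2.1 ∧
        j = j' + i := by
      rw [Nat.mul_succ] at hj
      by_cases h : j < (τ r).1 * t + (τ r).2.1
      · exact ⟨0, j, by omega, h, rfl⟩
      · exact ⟨j - ((τ r).1 * t + (τ r).2.1 - 1), (τ r).1 * t + (τ r).2.1 - 1, by omega, by omega,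
          by omega⟩
    refine hQ.of_residueRules hr
      (rhs := tickSymbols N ++ .inr (2 * r + 5) :: tickSymbols i)
      ?_ (matches_ticks_append.2 ⟨_, ?_, _, _, rfl, ih j hj', matches_ticks.2 rfl⟩)
    · exact List.mem_append_left _ (List.mem_append_right _
        (List.mem_map.2 ⟨i, List.mem_range.2 hi, rfl⟩))
    · rw [show N * (t + 1) + r = N + (N * t + r) by ring, ticks_add N, ticks_add j]
      simp only [List.append_assoc, List.cons_append]

theorem violation_cons (hQ : IsClosed (historyRules τ N c) Q) (b : Bool) {v : List Bool}
    (h : Q 2 v ∧ Q 3 v) : Q 2 (b :: v) ∧ Q 3 (b :: v) :=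
  ⟨hQ.of_bitRules (b := b) (rhs := [.inl b, .inr 3]) (by simp [bitRules])
      ⟨v, rfl, v, [], by simp, h.2, rfl⟩,
    hQ.of_bitRules (b := b) (rhs := [.inl b, .inr 3]) (by simp [bitRules])
      ⟨v, rfl, v, [], by simp, h.2, rfl⟩⟩

theorem violation_append (hQ : IsClosed (historyRules τ N c) Q) (u : List Bool) {v : List Bool}
    (h : Q 2 v ∧ Q 3 v) : Q 2 (u ++ v) ∧ Q 3 (u ++ v) := by
  induction u with
  | nil => exact h
  | cons b u ih => exact hQ.violation_cons b ih

/-- Surplus ticks are absorbed, together with `y`, by the nonterminal 1; since its productions give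
only nonempty words, `y` must not be empty. -/
theorem violation_over (hQ : IsClosed (historyRules τ N c) Q) (hN : 0 < N) {n j : ℕ}
    (hj : τ.high N n ≤ j) {y : List Bool} (hy : y ≠ []) :
    Q 2 (false :: (ticks n ++ false :: (ticks j ++ y))) ∧
      Q 3 (false :: (ticks n ++ false :: (ticks j ++ y))) := by
  have hr := Nat.mod_lt n hN
  have h1 := hQ.generates_over hr (n / N)
  rw [Nat.div_add_mod] at h1
  have hm : Matches Q [.inl false, .inr (2 * (n % N) + 4), .inr 1]
      (false :: (ticks n ++ false :: (ticks j ++ y))) := by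
    obtain ⟨d, rfl⟩ := Nat.exists_eq_add_of_le hj
    refine ⟨_, rfl, _, ticks d ++ y, ?_, h1, ticks d ++ y, [], by simp, hQ.one (by simp [hy]), rfl⟩
    rw [ticks_add (τ.high N n)]
    simp only [List.append_assoc, List.cons_append, high]
  exact ⟨hQ.of_residueRules hr (by simp [residueRules]) hm,
    hQ.of_residueRules hr (by simp [residueRules]) hm⟩

theorem violation_under (hQ : IsClosed (historyRules τ N c) Q) (hN : 0 < N) {n j : ℕ}
    (hl : 1 ≤ (τ (n % N)).2.1) (hj : j < τ.low N n) {y : List Bool} (hy : y ≠ []) :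
    Q 2 (false :: (ticks n ++ false :: (ticks j ++ false :: y))) ∧
      Q 3 (false :: (ticks n ++ false :: (ticks j ++ false :: y))) := by
  have hr := Nat.mod_lt n hN
  have h1 := hQ.generates_under hr hl (n / N) j hj
  rw [Nat.div_add_mod] at h1
  have hm : Matches Q [.inl false, .inr (2 * (n % N) + 5), .inl false, .inr 1]
      (false :: (ticks n ++ false :: (ticks j ++ false :: y))) :=
    ⟨_, rfl, _, false :: y, by simp, h1, y, rfl, y, [], by simp, hQ.one hy, rfl⟩
  exact ⟨hQ.of_residueRules hr (by simp [residueRules]) hm,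
    hQ.of_residueRules hr (by simp [residueRules]) hm⟩

end IsClosed

theorem isChain_ticks_append {n : ℕ} (hn : n ≠ 0) {x : List Bool}
    (hx : (false :: x).IsChain fun a b => a || b) :
    (false :: (ticks n ++ false :: x)).IsChain fun a b => a || b := by
  obtain ⟨n, rfl⟩ := Nat.exists_eq_succ_of_ne_zero hn
  rw [ticks, List.replicate_succ, List.cons_append]
  refine List.isChain_cons_cons.2 ⟨rfl, ?_⟩
  clear hn
  induction n with
  | zero => exact List.isChain_cons_cons.2 ⟨rfl, hx⟩
  | succ n ih => exact List.isChain_cons_cons.2 ⟨rfl, ih⟩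

/-- If the iteration from `m` accepts, then after a block of length `m`, either a fixed word is
continued, which gives no adjacent separators, or there is a violation. -/
theorem exists_prefix_or_violation_after_block {m n : ℕ} (hN : 0 < N) (h0 : τ 0 = (0, 0, 1))
    (hrun : Relation.ReflTransGen (τ.Step N) m n) (hn : τ (n % N) = (0, 1, 1)) :
    ∃ x, ((false :: (ticks m ++ false :: x)).IsChain fun a b => a || b) ∧
      ∀ Q, IsClosed (historyRules τ N c) Q → ∀ v, v <+: x ∨ ∀ y ≠ [],
        Q 2 (false :: (ticks m ++ false :: (v ++ y))) ∧
        Q 3 (false :: (ticks m ++ false :: (v ++ y))) := by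
  -- Zero has constant term 0, so the blocks of the run up to acceptance are nonempty and no
  -- separators are adjacent.
  have hne : ∀ m, 1 ≤ (τ (m % N)).2.1 → m ≠ 0 := by
    rintro m hm rfl
    simp [h0] at hm
  induction hrun using Relation.ReflTransGen.head_induction_on with
  | refl =>
    -- At the accepting number both bounds are 1: a further separator makes the next block too
    -- short, a tick makes it too long.
    refine ⟨[], isChain_ticks_append (hne n (by simp [hn])) (List.isChain_singleton _),
      fun Q hQ v => ?_⟩
    rcases v with _ | ⟨_ | _, v⟩
    · exact .inl (List.prefix_refl _)
    · exact .inr fun y hy => hQ.violation_under hN (n := n) (j := 0) (by simp [hn])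
        (by simp [low, hn]) (y := v ++ y) (by simp [hy])
    · exact .inr fun y hy => hQ.violation_over hN (n := n) (j := 1)
        (by simp [high, hn]) (y := v ++ y) (by simp [hy])
  | @head m m' hstep _ ih =>
    obtain ⟨x, hx, hv⟩ := ih
    obtain ⟨h1, h2, h3⟩ := hstep
    have hlow : τ.low N m = m' := h1.symm
    have hhigh : τ.high N m = m' + 1 := by rw [high, h2, h1]; ring
    refine ⟨ticks m' ++ false :: x, isChain_ticks_append (hne m h3) hx, fun Q hQ v => ?_⟩
    obtain ⟨i, rfl | ⟨v, rfl⟩⟩ := exists_eq_ticks_append v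
    · by_cases hi : i ≤ m'
      · left
        rw [show m' = i + (m' - i) by omega, ticks_add, List.append_assoc]
        exact List.prefix_append _ _
      · exact .inr fun y hy => hQ.violation_over hN (by omega) hy
    · rcases lt_trichotomy i m' with hi | rfl | hi
      · right
        intro y hy
        simpa using hQ.violation_under hN (n := m) h3 (j := i) (by omega) (y := v ++ y)
          (by simp [hy])
      · rcases hv Q hQ v with hv | hv
        · left
          simpa using hv
        · right
          intro y hy
          have := hQ.violation_append (false :: ticks m) (hv y hy)
          simpa using this
      · right
        intro y hy
        simpa using hQ.violation_over hN (n := m) (j := i) (by omega) (y := false :: (v ++ y))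
          (by simp)

/-- If the iteration accepts, then every word is a prefix of a fixed word without adjacent
separators, or every longer word contains a violation. -/
theorem exists_prefix_or_violation {n : ℕ} (hN : 0 < N) (h0 : τ 0 = (0, 0, 1))
    (hrun : Relation.ReflTransGen (τ.Step N) c n) (hn : τ (n % N) = (0, 1, 1)) :
    ∃ h : List Bool, (h.IsChain fun a b => a || b) ∧ ∀ Q, IsClosed (historyRules τ N c) Q →
      ∀ v, v <+: h ∨ ∀ y ≠ [], Q 2 (v ++ y) := by
  obtain ⟨x, hx, hv⟩ := exists_prefix_or_violation_after_block (c := c) hN h0 hrun hn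
  refine ⟨_, hx, fun Q hQ v => ?_⟩
  rcases v with _ | ⟨_ | _, v⟩
  · exact .inl (List.nil_prefix)
  · obtain ⟨i, rfl | ⟨v, rfl⟩⟩ := exists_eq_ticks_append v
    · by_cases hi : i ≤ c
      · left
        rw [show c = i + (c - i) by omega, ticks_add, List.append_assoc]
        exact List.prefix_append (false :: ticks i) _
      · right
        intro y hy
        refine hQ (2, .inl false :: ((List.range (c + 1)).map (fun _ => .inl true) ++ [.inr 1]))
          (mem_historyRules.2 (.inl List.mem_cons_self)) _ ⟨_, rfl, ?_⟩
        obtain ⟨d, rfl⟩ := Nat.exists_eq_add_of_le (show c + 1 ≤ i by omega)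
        rw [map_range_inl_true]
        refine matches_ticks_append.2 ⟨ticks d ++ y, ?_, ticks d ++ y, [], by simp,
          hQ.one (by simp [hy]), rfl⟩
        rw [ticks_add (c + 1)]
        exact List.append_assoc _ _ _
    · rcases lt_trichotomy i c with hi | rfl | hi
      · right
        intro y hy
        refine hQ (2, .inl false :: ((List.range i).map (fun _ => .inl true) ++
          [.inl false, .inr 1])) (mem_historyRules.2 (.inl (List.mem_cons_of_mem _
          (List.mem_map.2 ⟨i, List.mem_range.2 hi, rfl⟩)))) _ ⟨_, rfl, ?_⟩
        rw [map_range_inl_true]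
        exact matches_ticks_append.2 ⟨false :: (v ++ y), by simp, v ++ y, rfl, v ++ y, [], by simp,
          hQ.one (by simp [hy]), rfl⟩
      · rcases hv Q hQ v with hv | hv
        · left
          simpa using hv
        · right
          intro y hy
          simpa using (hv y hy).1
      · right
        intro y hy
        refine hQ (2, .inl false :: ((List.range (c + 1)).map (fun _ => .inl true) ++ [.inr 1]))
          (mem_historyRules.2 (.inl List.mem_cons_self)) _ ⟨_, rfl, ?_⟩
        obtain ⟨d, rfl⟩ := Nat.exists_eq_add_of_le (show c + 1 ≤ i by omega)
        rw [map_range_inl_true]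
        refine matches_ticks_append.2 ⟨ticks d ++ (false :: v ++ y), ?_,
          ticks d ++ (false :: v ++ y), [], by simp, hQ.one (by simp), rfl⟩
        rw [ticks_add (c + 1)]
        change (ticks (c + 1) ++ ticks d ++ false :: v) ++ y = _
        simp only [List.append_assoc, List.cons_append]
  · right
    intro y hy
    exact hQ (2, [.inl true, .inr 1]) (mem_historyRules.2 (.inr (.inr (.inr (.inl rfl))))) _
      ⟨v ++ y, rfl, v ++ y, [], by simp, hQ.one (by simp [hy]), rfl⟩

/-- If the iteration accepts, then the start symbol generates all nonempty words, and the
nonterminal `2` generates all words of some positive length. -/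
theorem exists_complete {n : ℕ} (hN : 0 < N) (h0 : τ 0 = (0, 0, 1))
    (hrun : Relation.ReflTransGen (τ.Step N) c n) (hn : τ (n % N) = (0, 1, 1)) :
    ∃ m, 0 < m ∧ ∀ Q, IsClosed (historyRules τ N c) Q →
      (∀ v, v ≠ [] → Q 0 v) ∧ ∀ v, v.length = m → Q 2 v := by
  obtain ⟨h, hchain, hh⟩ := exists_prefix_or_violation hN h0 hrun hn
  -- A word of length `h.length + 1` is no prefix of `h`, and the violation needs one more letter.
  refine ⟨h.length + 2, by omega, fun Q hQ => ⟨fun v hv => ?_, fun v hv => ?_⟩⟩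
  · obtain ⟨v, b₃, rfl⟩ := (List.eq_nil_or_concat' v).resolve_left hv
    rcases List.eq_nil_or_concat' v with rfl | ⟨v, b₂, rfl⟩
    · exact hQ.of_bitRules (b := b₃) (rhs := [.inl b₃]) (by simp [bitRules]) ⟨_, rfl, rfl⟩
    rcases List.eq_nil_or_concat' v with rfl | ⟨v, b₁, rfl⟩
    · exact hQ.of_endRules (b₁ := b₂) (b₂ := b₃) (b₃ := b₃) (rhs := [.inl b₂, .inl b₃])
        (by simp [endRules]) ⟨_, rfl, _, rfl, rfl⟩
    rcases v with _ | ⟨b, v⟩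
    · exact hQ.of_endRules (b₁ := b₁) (b₂ := b₂) (b₃ := b₃)
        (rhs := [.inl b₁, .inl b₂, .inl b₃]) (by simp [endRules]) ⟨_, rfl, _, rfl, _, rfl, rfl⟩
    -- Ticks in the second or third place from the end have their own productions. What remains is a
    -- word ending in two separators and a letter; its part before that letter is no prefix of `h`.
    cases b₂ with
    | true =>
      exact hQ.of_bitRules (b := b₃) (rhs := [.inr 1, .inl true, .inl b₃]) (by simp [bitRules])
        ⟨b :: v ++ [b₁], [true, b₃], by simp, hQ.one (by simp), _, rfl, _, rfl, rfl⟩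
    | false =>
      cases b₁ with
      | true =>
        exact hQ.of_endRules (b₁ := true) (b₂ := false) (b₃ := b₃)
          (rhs := [.inr 1, .inl true, .inl false, .inl b₃]) (by simp [endRules])
          ⟨b :: v, [true, false, b₃], by simp, hQ.one (by simp), _, rfl, _, rfl, _, rfl, rfl⟩
      | false =>
        have hnot : ¬ v ++ [false, false] <+: h := fun hp => by
          have := hchain.infix ((List.suffix_append v [false, false]).isInfix.trans hp.isInfix)
          simp at this
        exact hQ.of_bitRules (b := b) (rhs := [.inl b, .inr 2]) (by simp [bitRules])
          ⟨v ++ [false, false] ++ [b₃], by simp, v ++ [false, false] ++ [b₃], [], by simp,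
            (hh Q hQ _).resolve_left hnot _ (by simp), rfl⟩
  · obtain ⟨v, b, rfl⟩ := (List.eq_nil_or_concat' v).resolve_left (by rintro rfl; simp at hv)
    rw [List.length_append, List.length_singleton] at hv
    exact (hh Q hQ v).resolve_left (fun hp => by have := hp.length_le; omega) _ (by simp)

end Completeness

end AffineTable

/-! ### The reduction of partial recursive functions to grammars -/

namespace GrammarCode

variable {k : ℕ}

/-- Every partial recursive function `f` can be encoded in grammars: from `z` one can compute a
productive grammar that is regularly total if `f z = 0`, and not total if `f z` has another
value. -/
theorem exists_reduction (hk : 2 ≤ k) {f : ℕ →. ℕ} (hf : Nat.Partrec f) :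
    ∃ g : ℕ → ℕ, Computable g ∧ ∀ z, ∀ y ∈ f z,
      (y = 0 → g z ∈ regularlyTotal k) ∧ (y ≠ 0 → g z ∈ nonTotal k) := by
  obtain ⟨N, τ, c, hN, hc, h0, hsim⟩ := AffineTable.exists_simulation hf
  let G : ℕ → GrammarCode k := fun z => lift k (τ.historyRules N (c z))
  have hprod : ∀ z, (toGrammar (G z)).IsProductive := fun z =>
    lift_isProductive (AffineTable.historyRules_isProductive hN (c z))
  refine ⟨fun z => Encodable.encode (G z), ?_, fun z y hy => ?_⟩
  · have hinit : Primrec AffineTable.initialRules := by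
      have ht : Primrec fun n : ℕ => (List.range n).map fun _ => (Sum.inl true : Bool ⊕ ℕ) :=
        Primrec.list_map .list_range (.const _)
      refine Primrec.list_cons.comp (Primrec.pair (.const 2) (Primrec.list_cons.comp (.const _)
        (Primrec.list_append.comp (ht.comp .succ) (.const _)))) ?_
      exact Primrec.list_map .list_range (Primrec.pair (.const 2) (Primrec.list_cons.comp (.const _)
        (Primrec.list_append.comp (ht.comp .snd) (.const _))))
    -- Only `initialRules` varies with `z`. The table enters through a constant list, so its being
    -- noncomputable does no harm.
    have hrules : Primrec fun z => τ.historyRules N (c z) :=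
      Primrec.list_append.comp (hinit.comp hc) (.const _)
    exact (Primrec.encode.comp (Primrec.pair (.const 0)
      ((primrec_liftRules (k := k)).comp hrules))).to_comp
  · obtain ⟨n, hrun, hn⟩ := hsim z y hy
    refine ⟨fun h => ?_, fun h => ?_⟩
    · rw [if_pos h] at hn
      obtain ⟨m, hm, hcomp⟩ := AffineTable.exists_complete hN h0 hrun hn
      obtain ⟨hS, hY⟩ := hcomp (fun X v => ∀ w : List (Fin k), w.map letterClass = v →
        (toGrammar (G z)).GeneratesFrom X w) fun p hp v hv => lift_generates_of_matches hp hv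
      have hbit : ∀ (b : Bool) (p : ℕ × List (Bool ⊕ ℕ)), p ∈ AffineTable.bitRules b →
          p ∈ τ.historyRules N (c z) := fun b p hp =>
        AffineTable.mem_historyRules.2 (.inr (.inl ⟨b, hp⟩))
      have hmem : ∀ (p : ℕ × List (Fin k ⊕ ℕ)), p ∈ (G z).2 →
          toRule p ∈ (toGrammar (G z)).rules := fun p hp => mem_rules_iff.2 ⟨p, hp, rfl⟩
      refine ⟨G z, rfl, hprod z, (2 : ℕ), (1 : ℕ), (by decide : (2 : ℕ) ≠ 1),
        (by decide : (2 : ℕ) ≠ 0), (by decide : (1 : ℕ) ≠ 0),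
        fun a => ⟨?_, ?_, ?_⟩, m, hm, fun w hw _ => hS (w.map letterClass) (by simpa using hw) w rfl,
        fun w hw => hY (w.map letterClass) (by simpa using hw) w rfl⟩
      · exact hmem (0, [.inl a, .inr 2, .inr 1]) (mem_liftRules.2
          ⟨[.inl (letterClass a), .inr 2, .inr 1], hbit (letterClass a) _
            (by simp [AffineTable.bitRules]), .cons (inl_mem_liftSymbol.2 rfl)
            (.cons (inr_mem_liftSymbol.2 rfl) (.cons (inr_mem_liftSymbol.2 rfl) .nil))⟩)
      · exact hmem (1, [.inl a]) (mem_liftRules.2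
          ⟨[.inl (letterClass a)], hbit (letterClass a) _
            (by simp [AffineTable.bitRules]), .cons (inl_mem_liftSymbol.2 rfl) .nil⟩)
      · exact hmem (1, [.inl a, .inr 1]) (mem_liftRules.2
          ⟨[.inl (letterClass a), .inr 1], hbit (letterClass a) _
            (by simp [AffineTable.bitRules]), .cons (inl_mem_liftSymbol.2 rfl)
            (.cons (inr_mem_liftSymbol.2 rfl) .nil)⟩)
    · rw [if_neg h] at hn
      obtain ⟨Q, hQ, v, hv, hvQ⟩ := AffineTable.exists_sound h0 hrun hn
      obtain ⟨w, rfl⟩ := exists_letterClass hk v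
      exact ⟨G z, rfl, hprod z, fun ht => hvQ (of_lift_generates hQ
        (ht w (by simpa using hv)))⟩

end GrammarCode

/-! ### Regular totality implies totality -/

namespace ContextFreeGrammar

variable {A : Type*} {g : ContextFreeGrammar A}

theorem IsRegularlyTotal.isTotal (h : g.IsRegularlyTotal) : g.IsTotal := by
  obtain ⟨Y, T, -, -, -, hr, n, -, hS, hY⟩ := h
  have hT : ∀ w : List A, w ≠ [] → g.GeneratesFrom T w := by
    intro w hw
    induction w with
    | nil => exact absurd rfl hw
    | cons a w ih =>
      rcases eq_or_ne w [] with rfl | h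
      · exact Produces.single ⟨_, (hr a).2.1, ContextFreeRule.Rewrites.input_output⟩
      · exact (Produces.single ⟨_, (hr a).2.2, ContextFreeRule.Rewrites.input_output⟩).trans
          ((ih h).append_left [Symbol.terminal a])
  intro w hw
  rcases le_or_gt w.length (n + 1) with hl | hl
  · exact hS w hw hl
  · obtain ⟨a, w, rfl⟩ := List.exists_cons_of_ne_nil hw
    rw [List.length_cons] at hl
    have h1 := (hY (w.take n) (by rw [List.length_take]; omega)).append_right
      [Symbol.nonterminal T]
    have h2 := (hT (w.drop n) (by rw [ne_eq, List.drop_eq_nil_iff]; omega)).append_left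
      ((w.take n).map Symbol.terminal)
    rw [← List.map_append, List.take_append_drop] at h2
    exact (Produces.single ⟨_, (hr a).1, ContextFreeRule.Rewrites.input_output⟩).trans
      ((h1.trans h2).append_left [Symbol.terminal a])

end ContextFreeGrammar

/-! ### Effective inseparability by diagonalisation -/

/-- Two disjoint sets are effectively inseparable if all pairs of disjoint sets of the form
`{z | f z = 0}` and `{z | f z ≠ 0}`, with `f` partial recursive, can be reduced to them. -/
theorem effectivelyInseparable_of_reduction {φ : ℕ → ℕ →. ℕ} (hφ : Partrec₂ φ) {A B : Set ℕ}
    (hAB : A ∩ B = ∅) (hred : ∀ f : ℕ →. ℕ, Nat.Partrec f → ∃ g : ℕ → ℕ, Computable g ∧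
      ∀ z, ∀ y ∈ f z, (y = 0 → g z ∈ A) ∧ (y ≠ 0 → g z ∈ B)) :
    EffectivelyInseparable φ A B := by
  open Nat.Partrec in
  -- Self-application is built in: `z` carries a code as its first component, and that code is run
  -- on all of `z`.
  obtain ⟨g, hg, hgAB⟩ := hred
    (fun z => (Denumerable.ofNat Code z.unpair.1).eval z)
    (Partrec.nat_iff.1 (Code.eval_part.comp
      ((Computable.ofNat Code).comp (Computable.fst.comp Computable.unpair)) .id))
  have hW : ∀ (π : ℕ → ℕ) (b : ℕ), Computable π → Partrec fun z => (φ (π z) (g z)).map fun _ => b :=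
    fun π b hπ => (hφ.comp hπ hg).map (Computable.const b).to₂
  -- With `u` and `v` read off `z`, the answer is 1 only if `g z` is in the `u`-th set, and 0 only
  -- if it is in the `v`-th. Run through `g`, the answer 1 puts `g z` into `B`, hence into the
  -- `v`-th set, and 0 puts it into the `u`-th: both contradict disjointness.
  obtain ⟨s, hs, hspec⟩ := Partrec.merge'
    (hW (fun z => z.unpair.2.unpair.1) 1
      (Computable.fst.comp (Computable.unpair.comp (Computable.snd.comp .unpair))))
    (hW (fun z => z.unpair.2.unpair.2) 0
      (Computable.snd.comp (Computable.unpair.comp (Computable.snd.comp .unpair))))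
  obtain ⟨d, rfl⟩ := Nat.Partrec.Code.exists_code.1 (Partrec.nat_iff.1 hs)
  let z : ℕ → ℕ → ℕ := fun u v => Nat.pair (Encodable.encode d) (Nat.pair u v)
  have hz : Computable₂ z :=
    (Primrec₂.natPair.comp (Primrec.const _) (Primrec₂.natPair.comp .fst .snd)).to_comp
  refine ⟨hAB, fun u v => Part.some (g (z u v)), (hg.comp hz).partrec, fun u v hu hv huv =>
    ⟨g (z u v), Part.mem_some _, fun hmem => ?_⟩⟩
  have hdisj : ∀ x, x ∈ reSet φ u → x ∈ reSet φ v → False := fun x h1 h2 => by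
    have : x ∈ reSet φ u ∩ reSet φ v := ⟨h1, h2⟩
    rwa [huv] at this
  obtain ⟨hval, hdom⟩ := hspec (z u v)
  have hz2 : (z u v).unpair = (Encodable.encode d, Nat.pair u v) := Nat.unpair_pair _ _
  simp only [hz2, Nat.unpair_pair] at hval hdom
  obtain ⟨y, hy⟩ := Part.dom_iff_mem.1 (hdom.2 (by simpa [reSet] using hmem))
  have hgy := hgAB (z u v) y (by simpa [hz2] using hy)
  rcases hval y hy with h | h
  · obtain ⟨x, hx, rfl⟩ := (Part.mem_map_iff _).1 h
    exact hdisj _ (Part.dom_iff_mem.2 ⟨x, hx⟩) (hv (hgy.2 one_ne_zero))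
  · obtain ⟨x, hx, rfl⟩ := (Part.mem_map_iff _).1 h
    exact hdisj _ (hu (hgy.1 rfl)) (Part.dom_iff_mem.2 ⟨x, hx⟩)

theorem mainTheorem3 (φ : ℕ → ℕ →. ℕ) (hφ : IsAcceptableEnumeration φ) (k : ℕ) (hk : 2 ≤ k) :
    EffectivelyInseparable φ (GrammarCode.regularlyTotal k) (GrammarCode.nonTotal k) := by
  refine effectivelyInseparable_of_reduction hφ.partrec ?_
    fun f hf => GrammarCode.exists_reduction hk hf
  rw [Set.eq_empty_iff_forall_notMem]
  rintro m ⟨⟨G, rfl, -, hG⟩, G', he, -, hG'⟩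
  obtain rfl := Encodable.encode_injective he
  exact hG' hG.isTotal
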